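/- Let $\Omega\subset\mathbb{R}^d$ be compact and convex with non-empty interior $\Omega^\circ$, and let $p_0,p_1$ be probability densities on $\Omega$ that are continuous and satisfy $\underline{p}\le p_j\le\overline{p}$ on $\Omega$ for some constants $0<\underline p\le\overline p<\infty$. For positive functions $q_0,q_1$ on $\Omega$, for $z\in\Omega^\circ$ and $t\in[0,1]$ put $S_t(z)=\{\delta\in\mathbb{R}^d: z-t\delta\in\Omega,\ z+(1-t)\delta\in\Omega\}$, $$v_{q_0,q_1}(t,z)=\frac{\int_{S_t(z)}\delta\,q_0(z-t\delta)\,q_1(z+(1-t)\delta)\,d\delta}{\int_{S_t(z)}q_0(z-t\delta)\,q_1(z+(1-t)\delta)\,d\delta},\qquad \omega_{q_0,q_1}(\eta)=\sup_{z,z'\in\Omega,\ \|z-z'\|\le\eta}\ \max_{j=0,1}\Bigl|\frac{q_j(z)}{q_j(z')}-1\Bigr| .$$ Let $v=v_{p_0,p_1}$ (that is, $v(t,z)=\mathbb{E}[X_1-X_0\mid (1-t)X_0+tX_1=z]$ for independent $X_0\sim p_0$, $X_1\sim p_1$) and $\omega=\omega_{p_0,p_1}$. For estimators $\widehat p_0,\widehat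 p_1>0$ on $\Omega$ let $\widehat v=v_{\widehat p_0,\widehat p_1}$, $\widehat\omega=\omega_{\widehat p_0,\widehat p_1}$, and suppose that $$r_n=\sup_{x\in\Omega}\max_{j=0,1}\bigl|\ln(\widehat p_j(x)/p_j(x))\bigr|<\infty .$$ Suppose that both $\omega$ and $\widehat\omega$ satisfy the Osgood condition: $\int_1^{u}\frac{ds}{s+\omega(s)}\to-\infty$ as $u\downarrow0$, and likewise for $\widehat\omega$. Let $\Psi(u)=\int_1^u\frac{ds}{s+\omega(s)}$ for $u>0$, with the conventions $\Psi(0)=-\infty$ and $\Psi^{-1}(-\infty)=0$. Then for every $x\in\Omega^\circ$ the integral equations $$\mathfrak{R}(t,x)=x+\int_0^t v(s,\mathfrak{R}(s,x))\,ds,\qquad \widehat{\mathfrak{R}}(t,x)=x+\int_0^t\widehat v(s,\widehat{\mathfrak{R}}(s,x))\,ds,\qquad t\in[0,1],$$ each have a unique solution on $[0,1]$ with values in $\Omega^\circ$ for $t<1$, and every solution on a shorter interval $[0,T]$ with values in $\Omega^\circ$ for $t<T$ is a restriction of it. Moreover, there is a constant $C>0$, depending only on $d$, $\mathrm{diam}(\Omega)$,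 $\underline p$ and $\overline p$, such that for all $\varepsilon,\gamma>0$ and all $x$ whose closed $\varepsilon$-ball is contained in $\Omega$ and for which $\mathrm{dist}(\mathfrak{R}(1,x),\partial\Omega)\ge2\gamma$, $$\|\widehat{\mathfrak{R}}(1,x)-\mathfrak{R}(1,x)\|\le\Psi^{-1}\Bigl(\Psi\bigl(2\,\mathrm{diam}(\Omega)(e^{4r_n}-1)\bigr)+\frac{C}{\min\{\varepsilon,\gamma\}}\ln\Bigl(\frac{\mathrm{diam}(\Omega)}{\varepsilon}\Bigr)+\frac{C}{\varepsilon\gamma}\Bigr).$$ If, in addition, $\omega(u)\le Lu$ for all $u\ge0$, then $$\|\widehat{\mathfrak{R}}(1,x)-\mathfrak{R}(1,x)\|\le2\,\mathrm{diam}(\Omega)(e^{4r_n}-1)\exp\Bigl(\frac{C(L+1)}{\min\{\varepsilon,\gamma\}}\ln\Bigl(\frac{\mathrm{diam}(\Omega)}{\varepsilon}\Bigr)+\frac{C(L+1)}{\varepsilon\gamma}\Bigr).$$ -/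

import Mathlib

open MeasureTheory Set Filter Topology

noncomputable section

namespace RectifiedFlow

/-- Points of `ℝ^d`, with the Euclidean norm and Lebesgue measure. -/
abbrev Pt (d : ℕ) : Type := EuclideanSpace ℝ (Fin d)

variable {d : ℕ}

/-- `Ω^{-ε}`: the points whose closed `ε`-ball lies in `Ω`. -/
def erosion (Ω : Set (Pt d)) (ε : ℝ) : Set (Pt d) :=
  {x | Metric.closedBall x ε ⊆ Ω}

/-- `p` is a Lebesgue probability density on `Ω`, continuous there, with values in `[lo, hi]`.
Values of `p` outside `Ω` are never used. -/
structure IsDensityOn (Ω : Set (Pt d)) (lo hi : ℝ) (p : Pt d → ℝ) : Prop where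
  continuousOn : ContinuousOn p Ω
  lower : ∀ x ∈ Ω, lo ≤ p x
  upper : ∀ x ∈ Ω, p x ≤ hi
  integral_eq_one : ∫ x in Ω, p x = 1

/-- The set `S_t(z) = (z - Ω)/t ∩ (Ω - z)/(1 - t)` of admissible displacements, written so that it
also makes sense at `t = 0` and `t = 1`. -/
def admissible (Ω : Set (Pt d)) (t : ℝ) (z : Pt d) : Set (Pt d) :=
  {δ | z - t • δ ∈ Ω ∧ z + (1 - t) • δ ∈ Ω}

/-- The velocity field of the pair `(p₀, p₁)`, both regarded as supported on `Ω`: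
`v(t,z) = ∫_{S_t(z)} δ p₀(z-tδ) p₁(z+(1-t)δ) dδ / ∫_{S_t(z)} p₀(z-tδ) p₁(z+(1-t)δ) dδ`.
For densities it is the conditional expectation `E[X₁ - X₀ | (1-t)X₀ + tX₁ = z]` for independent
`X₀ ∼ p₀`, `X₁ ∼ p₁`; see `condExp_ae_eq_velocity` below. -/
def velocity (Ω : Set (Pt d)) (p₀ p₁ : Pt d → ℝ) (t : ℝ) (z : Pt d) : Pt d :=
  (∫ δ in admissible Ω t z, p₀ (z - t • δ) * p₁ (z + (1 - t) • δ))⁻¹ •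
    ∫ δ in admissible Ω t z, (p₀ (z - t • δ) * p₁ (z + (1 - t) • δ)) • δ

/-- `velocity` is the regular version of the conditional expectation: if `X₀` and `X₁` are
independent with densities `p₀` and `p₁` on `Ω`, then `E[X₁ - X₀ | X_t] = v(t, X_t)` almost surely,
where `X_t = (1 - t) X₀ + t X₁`. -/
theorem condExp_ae_eq_velocity {S : Type*} [mS : MeasurableSpace S] (P : Measure S)
    [IsProbabilityMeasure P] (X₀ X₁ : S → Pt d) (hX₀ : Measurable X₀) (hX₁ : Measurable X₁)
    (hind : ProbabilityTheory.IndepFun X₀ X₁ P) (Ω : Set (Pt d)) (hΩ : IsCompact Ω)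
    (p₀ p₁ : Pt d → ℝ) (hc₀ : ContinuousOn p₀ Ω) (hc₁ : ContinuousOn p₁ Ω)
    (hp₀ : ∀ x ∈ Ω, 0 ≤ p₀ x) (hp₁ : ∀ x ∈ Ω, 0 ≤ p₁ x)
    (hl₀ : P.map X₀ = (volume.restrict Ω).withDensity fun x => ENNReal.ofReal (p₀ x))
    (hl₁ : P.map X₁ = (volume.restrict Ω).withDensity fun x => ENNReal.ofReal (p₁ x)) (t : ℝ) :
    P[fun a => X₁ a - X₀ a |
        MeasurableSpace.comap (fun a => (1 - t) • X₀ a + t • X₁ a) inferInstance]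
      =ᵐ[P] fun a => velocity Ω p₀ p₁ t ((1 - t) • X₀ a + t • X₁ a) := by
  classical
  have hmΩ := hΩ.measurableSet
  -- extend the densities by zero
  set g₀ : Pt d → ℝ := Ω.indicator p₀ with hg₀
  set g₁ : Pt d → ℝ := Ω.indicator p₁ with hg₁
  have mg₀ : Measurable g₀ := by
    have := hc₀.measurable_piecewise (g := fun _ => (0 : ℝ)) continuousOn_const hmΩ
    rw [hg₀, ← Set.piecewise_eq_indicator]
    exact this
  have mg₁ : Measurable g₁ := by
    have := hc₁.measurable_piecewise (g := fun _ => (0 : ℝ)) continuousOn_const hmΩ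
    rw [hg₁, ← Set.piecewise_eq_indicator]
    exact this
  have g₀0 : ∀ x, 0 ≤ g₀ x := fun x => Set.indicator_nonneg hp₀ x
  have g₁0 : ∀ x, 0 ≤ g₁ x := fun x => Set.indicator_nonneg hp₁ x
  have ext : ∀ p : Pt d → ℝ, ((volume.restrict Ω).withDensity fun x => ENNReal.ofReal (p x))
      = volume.withDensity fun x => ENNReal.ofReal (Ω.indicator p x) := by
    intro p
    rw [← withDensity_indicator hmΩ]
    congr 1
    ext x
    by_cases hx : x ∈ Ω <;> simp [hx]
  rw [ext p₀, ← hg₀] at hl₀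
  rw [ext p₁, ← hg₁] at hl₁
  -- the joint density of displacement and position
  set h : Pt d → Pt d → ℝ := fun z δ => g₀ (z - t • δ) * g₁ (z + (1 - t) • δ) with hh
  have h0 : ∀ z δ, 0 ≤ h z δ := fun z δ => mul_nonneg (g₀0 _) (g₁0 _)
  have mh : Measurable (fun q : Pt d × Pt d => h q.1 q.2) := by
    simp only [hh]; fun_prop
  have madm : ∀ z, MeasurableSet (admissible Ω t z) := fun z => by
    have m1 : Measurable fun δ : Pt d => z - t • δ := by fun_prop
    have m2 : Measurable fun δ : Pt d => z + (1 - t) • δ := by fun_prop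
    exact (m1 hmΩ).inter (m2 hmΩ)
  have hind_eq : ∀ z δ, h z δ = (admissible Ω t z).indicator
      (fun δ => p₀ (z - t • δ) * p₁ (z + (1 - t) • δ)) δ := by
    intro z δ
    simp only [hh, hg₀, hg₁, admissible, Set.indicator, Set.mem_ofPred_eq]
    split_ifs <;> simp_all
  have vel : ∀ z, velocity Ω p₀ p₁ t z = (∫ δ, h z δ)⁻¹ • ∫ δ, h z δ • δ := by
    intro z
    unfold velocity
    rw [← integral_indicator (madm z), ← integral_indicator (madm z)]
    congr 2
    · simp only [hind_eq]
    · ext1 δ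
      rw [hind_eq]
      by_cases hδ : δ ∈ admissible Ω t z <;> simp [hδ]
  have mden : StronglyMeasurable fun z => ∫ δ, h z δ :=
    mh.stronglyMeasurable.integral_prod_right
  have mnum : StronglyMeasurable fun z => ∫ δ, h z δ • δ :=
    StronglyMeasurable.integral_prod_right (f := fun z δ : Pt d => h z δ • δ)
      (mh.smul measurable_snd).stronglyMeasurable
  have mvel : StronglyMeasurable (velocity Ω p₀ p₁ t) := by
    have : velocity Ω p₀ p₁ t = fun z => (∫ δ, h z δ)⁻¹ • ∫ δ, h z δ • δ := funext vel
    rw [this]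
    exact (mden.measurable.inv.smul mnum.measurable).stronglyMeasurable
  -- the law of (X_t, X₁ - X₀)
  set Z : S → Pt d := fun a => (1 - t) • X₀ a + t • X₁ a with hZ
  have mZ : Measurable Z := by fun_prop
  set W : S → Pt d × Pt d := fun a => (Z a, X₁ a - X₀ a) with hW
  have mW : Measurable W := by fun_prop
  have joint : P.map (fun a => (X₀ a, X₁ a)) =
      ((volume : Measure (Pt d)).prod volume).withDensity
        fun q => ENNReal.ofReal (g₀ q.1 * g₁ q.2) := by
    rw [(ProbabilityTheory.indepFun_iff_map_prod_eq_prod_map_map hX₀.aemeasurable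
      hX₁.aemeasurable).1 hind, hl₀, hl₁, prod_withDensity (by fun_prop) (by fun_prop)]
    congr 1
    ext q
    rw [ENNReal.ofReal_mul (g₀0 _)]
  set T : Pt d × Pt d → Pt d × Pt d := fun q => (q.1 - t • q.2, q.1 + (1 - t) • q.2) with hT
  set U : Pt d × Pt d → Pt d × Pt d := fun q => ((1 - t) • q.1 + t • q.2, q.2 - q.1) with hU
  have mT : Measurable T := by fun_prop
  have mU : Measurable U := by fun_prop
  have UT : ∀ q, U (T q) = q := by
    intro q
    ext1
    · simp only [hU, hT]; module
    · simp only [hU, hT]; module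
  have presT : MeasurePreserving T ((volume : Measure (Pt d)).prod volume)
      ((volume : Measure (Pt d)).prod volume) := by
    have s1 : MeasurePreserving (fun q : Pt d × Pt d => (q.1, q.2 - t • q.1))
        ((volume : Measure (Pt d)).prod volume) ((volume : Measure (Pt d)).prod volume) := by
      refine (MeasurePreserving.id (volume : Measure (Pt d))).skew_product
        (g := fun a b => b - t • a) (by fun_prop) (Filter.Eventually.of_forall fun a => ?_)
      exact map_sub_right_eq_self volume (t • a)
    have s2 := measurePreserving_prod_add (volume : Measure (Pt d)) (volume : Measure (Pt d))
    have sw := Measure.measurePreserving_swap (μ := (volume : Measure (Pt d)))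
      (ν := (volume : Measure (Pt d)))
    have s := s2.comp (sw.comp (s1.comp sw))
    convert s using 1
    ext1 q
    simp only [hT, Function.comp, Prod.swap]
    ext1
    · rfl
    · simp only; module
  have law : P.map W = ((volume : Measure (Pt d)).prod volume).withDensity
      fun q => ENNReal.ofReal (h q.1 q.2) := by
    have hWU : W = U ∘ fun a => (X₀ a, X₁ a) := rfl
    rw [hWU, ← Measure.map_map mU (by fun_prop), joint]
    ext B hB
    rw [Measure.map_apply mU hB, withDensity_apply _ (mU hB), withDensity_apply _ hB,
      ← presT.setLIntegral_comp_preimage (mU hB) (by fun_prop)]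
    have : T ⁻¹' (U ⁻¹' B) = B := by ext q; simp [UT]
    rw [this]
  have transfer : ∀ F : Pt d × Pt d → Pt d, Measurable F → ∀ B : Set (Pt d), MeasurableSet B →
      ∫ a in Z ⁻¹' B, F (W a) ∂P = ∫ q in B ×ˢ univ, h q.1 q.2 • F q
        ∂((volume : Measure (Pt d)).prod volume) := by
    intro F hF B hB
    have e1 : Z ⁻¹' B = W ⁻¹' (B ×ˢ univ) := by ext a; simp [hW]
    rw [e1, ← setIntegral_map (hB.prod MeasurableSet.univ) hF.aestronglyMeasurable mW.aemeasurable,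
      law, setIntegral_withDensity_eq_setIntegral_toReal_smul (by fun_prop)
        (Filter.Eventually.of_forall fun _ => by simp) _ (hB.prod MeasurableSet.univ)]
    congr 1
    ext1 q
    rw [ENNReal.toReal_ofReal (h0 _ _)]
  -- integrability
  obtain ⟨K, hK⟩ := hΩ.isBounded.exists_norm_le
  have bd : ∀ z δ, h z δ ≠ 0 → ‖δ‖ ≤ 2 * K := by
    intro z δ hne
    have hδ : δ ∈ admissible Ω t z := by
      by_contra hcon
      exact hne (by rw [hind_eq]; simp [hcon])
    have e : δ = (z + (1 - t) • δ) - (z - t • δ) := by module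
    rw [e]
    refine (norm_sub_le _ _).trans ?_
    linarith [hK _ hδ.1, hK _ hδ.2]
  have hint : Integrable (fun q : Pt d × Pt d => h q.1 q.2)
      ((volume : Measure (Pt d)).prod volume) := by
    refine ⟨mh.aestronglyMeasurable, ?_⟩
    rw [hasFiniteIntegral_iff_ofReal (Filter.Eventually.of_forall fun q => h0 _ _)]
    have : (P.map W) univ = 1 := by
      rw [Measure.map_apply mW MeasurableSet.univ]; simp
    rw [law, withDensity_apply _ MeasurableSet.univ, Measure.restrict_univ] at this
    rw [this]; exact ENNReal.one_lt_top
  have smul_le : ∀ z δ, ‖h z δ • δ‖ ≤ h z δ * (2 * K) := by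
    intro z δ
    rw [norm_smul, Real.norm_of_nonneg (h0 _ _)]
    by_cases hne : h z δ = 0
    · simp [hne]
    · exact mul_le_mul_of_nonneg_left (bd z δ hne) (h0 _ _)
  have hint2 : Integrable (fun q : Pt d × Pt d => h q.1 q.2 • q.2)
      ((volume : Measure (Pt d)).prod volume) :=
    (hint.mul_const (2 * K)).mono' (mh.smul measurable_snd).aestronglyMeasurable
      (Filter.Eventually.of_forall fun q => smul_le _ _)
  have slice : ∀ᵐ z : Pt d, Integrable (fun δ => h z δ) := hint.prod_right_ae
  have velbd : ∀ z, ‖velocity Ω p₀ p₁ t z‖ ≤ 2 * |K| := by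
    intro z
    rw [vel, norm_smul, norm_inv]
    by_cases hz : Integrable (fun δ => h z δ)
    · have hd0 : 0 ≤ ∫ δ, h z δ := integral_nonneg (h0 z)
      have : ‖∫ δ, h z δ • δ‖ ≤ (∫ δ, h z δ) * (2 * |K|) := by
        rw [← integral_mul_const]
        refine norm_integral_le_of_norm_le (hz.mul_const _)
          (Filter.Eventually.of_forall fun δ => (smul_le z δ).trans ?_)
        exact mul_le_mul_of_nonneg_left (by linarith [le_abs_self K]) (h0 _ _)
      rw [Real.norm_of_nonneg hd0]
      rcases hd0.eq_or_lt with h1 | h1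
      · rw [← h1]; simp
      · rw [inv_mul_le_iff₀ h1]; linarith
    · rw [integral_undef hz]; simp
  have hdX : Integrable (fun a => X₁ a - X₀ a) P := by
    have hae : ∀ X : S → Pt d, Measurable X → ∀ g : Pt d → ℝ,
        P.map X = volume.withDensity (fun x => ENNReal.ofReal (Ω.indicator g x)) →
        Measurable (Ω.indicator g) → Integrable X P := by
      intro X hX g hlaw hmg
      refine Integrable.of_bound hX.aestronglyMeasurable K ?_
      have hmem : ∀ᵐ a ∂P, X a ∈ Ω := by
        refine ae_of_ae_map (p := fun x => x ∈ Ω) hX.aemeasurable ?_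
        rw [hlaw, ae_withDensity_iff (by fun_prop)]
        refine Filter.Eventually.of_forall fun x hx => ?_
        by_contra hcon
        exact hx (by simp [hcon])
      filter_upwards [hmem] with a ha using hK _ ha
    exact (hae X₁ hX₁ p₁ hl₁ mg₁).sub (hae X₀ hX₀ p₀ hl₀ mg₀)
  have hvX : Integrable (fun a => velocity Ω p₀ p₁ t (Z a)) P :=
    Integrable.of_bound (mvel.measurable.comp mZ).aestronglyMeasurable (2 * |K|)
      (Filter.Eventually.of_forall fun a => velbd _)
  refine (ae_eq_condExp_of_forall_setIntegral_eq mZ.comap_le hdX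
    (fun s _ _ => hvX.integrableOn) ?_ ?_).symm
  · rintro s ⟨B, hB, rfl⟩ -
    have l := transfer (fun q => velocity Ω p₀ p₁ t q.1) (mvel.measurable.comp measurable_fst) B hB
    have r := transfer (fun q => q.2) measurable_snd B hB
    simp only [hW] at l r
    rw [l, r]
    have hvq : Integrable (fun q : Pt d × Pt d => h q.1 q.2 • velocity Ω p₀ p₁ t q.1)
        ((volume : Measure (Pt d)).prod volume) := by
      refine (hint.mul_const (2 * |K|)).mono'
        (mh.smul (mvel.measurable.comp measurable_fst)).aestronglyMeasurable
        (Filter.Eventually.of_forall fun q => ?_)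
      rw [norm_smul, Real.norm_of_nonneg (h0 _ _)]
      exact mul_le_mul_of_nonneg_left (velbd _) (h0 _ _)
    rw [setIntegral_prod _ hvq.integrableOn, setIntegral_prod _ hint2.integrableOn]
    simp only [Measure.restrict_univ]
    refine integral_congr_ae (ae_restrict_of_ae ?_)
    filter_upwards [slice] with z hz
    rw [integral_smul_const, vel, smul_smul]
    by_cases h1 : ∫ δ, h z δ = 0
    · have h2 : (fun δ => h z δ) =ᵐ[volume] 0 := (integral_eq_zero_iff_of_nonneg (h0 z) hz).1 h1
      have h3 : ∫ δ, h z δ • δ = 0 := by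
        rw [← integral_zero (Pt d) (Pt d) (μ := volume)]
        refine integral_congr_ae ?_
        filter_upwards [h2] with δ hδ
        simp [hδ]
      rw [h3, smul_zero]
    · rw [mul_inv_cancel₀ h1, one_smul]
  · exact (mvel.comp_measurable (comap_measurable Z)).aestronglyMeasurable

/-- The modulus of continuity of the ratios
`ω(η) = sup_{z, z' ∈ Ω, ‖z - z'‖ ≤ η} max_j |p_j(z) / p_j(z') - 1|`. -/
def ratioModulus (Ω : Set (Pt d)) (p₀ p₁ : Pt d → ℝ) (η : ℝ) : ℝ :=
  sSup {r | ∃ z ∈ Ω, ∃ z' ∈ Ω, ‖z - z'‖ ≤ η ∧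
    r = max |p₀ z / p₀ z' - 1| |p₁ z / p₁ z' - 1|}

/-- A primitive `u ↦ ∫ du / (u + ω(u))` on `(0, ∞)`, based at `1`. The choice of the base point
changes neither `IsOsgood` nor the value of `Ψ⁻¹(Ψ(a) + b)`. -/
def psiReal (ω : ℝ → ℝ) (u : ℝ) : ℝ :=
  ∫ s in (1 : ℝ)..u, 1 / (s + ω s)

/-- The Osgood condition on `u + ω(u)`: `Ψ(ε) → -∞` as `ε ↓ 0`. -/
def IsOsgood (ω : ℝ → ℝ) : Prop :=
  Tendsto (psiReal ω) (𝓝[>] 0) atBot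

open Classical in
/-- `Ψ` on `[0, ∞)`, with `Ψ(0) = -∞`. -/
def psi (ω : ℝ → ℝ) (u : ℝ) : EReal :=
  if 0 < u then (psiReal ω u : EReal) else ⊥

/-- The inverse of `Ψ : [0, ∞) → [-∞, ∞)`; in particular `Ψ⁻¹(-∞) = 0`. -/
def psiInv (ω : ℝ → ℝ) (y : EReal) : ℝ :=
  sSup {u | 0 ≤ u ∧ psi ω u ≤ y}

/-- `max_j |ln (q_j(x) / p_j(x))|`. -/
def logRatio (p₀ p₁ q₀ q₁ : Pt d → ℝ) (x : Pt d) : ℝ :=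
  max |Real.log (q₀ x / p₀ x)| |Real.log (q₁ x / p₁ x)|

/-- The estimation error `sup_{x ∈ Ω} max_j |ln (q_j(x) / p_j(x))|`. -/
def logRatioError (Ω : Set (Pt d)) (p₀ p₁ q₀ q₁ : Pt d → ℝ) : ℝ :=
  sSup (logRatio p₀ p₁ q₀ q₁ '' Ω)

/-- `y` is a Carathéodory solution on `[0, T]` of `y(t) = x + ∫₀ᵗ v(s, y(s)) ds`. A velocity field
is only meaningful in the interior of `Ω`, so the path has to stay there before time `T`. -/
structure IsSolution (Ω : Set (Pt d)) (v : ℝ → Pt d → Pt d) (x : Pt d) (T : ℝ)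
    (y : ℝ → Pt d) : Prop where
  mem_interior : ∀ t ∈ Ico 0 T, y t ∈ interior Ω
  integrable : IntervalIntegrable (fun s => v s (y s)) volume 0 T
  eq_integral : ∀ t ∈ Icc 0 T, y t = x + ∫ s in (0 : ℝ)..t, v s (y s)

/-- The flow of `v` from `x` is uniquely defined: there is a solution on `[0, 1]`, and every
solution, on `[0, 1]` or on a shorter interval, is a restriction of it. -/
def HasUniqueFlow (Ω : Set (Pt d)) (v : ℝ → Pt d → Pt d) (x : Pt d) : Prop :=
  ∃ y, IsSolution Ω v x 1 y ∧
    ∀ T ∈ Ioc (0 : ℝ) 1, ∀ y', IsSolution Ω v x T y' → EqOn y' y (Icc 0 T)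

end RectifiedFlow

end

/-!
Given `X_t = z`, a displacement `δ` has density proportional to `p₀ (z - t δ) p₁ (z + (1 - t) δ)` on
the convex set `S_t(z)`, and the velocity is the barycentre of this density. Two mechanisms drive
the argument.

*Convexity.* The barycentre lies in `S_t(z)`, so along a solution `y` both `y - t v` and
`y + (1 - t) v` stay in `Ω`: at every instant the path points to a target in `Ω` that would be
reached at time `1`. Hence `y t` is a convex combination of the start `x` and a point of `Ω`, and it
keeps distance `(1 - t) ε` from the boundary; read backwards from `y 1`, it keeps distance `t γ`.

*Oscillation of the velocity.* The barycentres of two densities differ by at most a multiple of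
their relative `L¹` distance. Replacing `p_j` by an estimator costs `exp (2 r) - 1`. Moving `z` by
`u` at distance `ρ` from the boundary costs `ω u + u / ρ`: the values of the density change by
`ω u`, while `S_t(z)` gains and loses a fraction `u / ρ` of its volume, because it contains a ball
of radius `ρ` and shrinking it by the factor `1 - u / ρ` compensates the shift.

The distance `f` of two paths therefore satisfies `f ≤ a + ∫ K (f + ω f)`, and the Osgood inequality
gives `f ≤ Ψ⁻¹ (Ψ a + K)`. For `a = 0` this is uniqueness; applied to Euler approximations it shows
that they converge, which is existence; with the error of the estimated velocity for `a` it is the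
stability estimate.
-/

namespace RectifiedFlow

section WeightedMean

variable {E : Type*} [NormedAddCommGroup E] [NormedSpace ℝ E] {F G : E → ℝ} {D : ℝ}

lemma norm_smul_self_le (hFD : ∀ δ, F δ ≠ 0 → ‖δ‖ ≤ D) (δ : E) : ‖F δ • δ‖ ≤ |F δ| * D := by
  rw [norm_smul, Real.norm_eq_abs]
  by_cases h : F δ = 0
  · simp [h]
  · exact mul_le_mul_of_nonneg_left (hFD δ h) (abs_nonneg _)

variable [MeasurableSpace E] {μ : Measure E}

/-- The barycentre of the mass distribution `F • μ`; it is `0` if the total mass is `0` or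
infinite. -/
noncomputable def weightedMean (μ : Measure E) (F : E → ℝ) : E :=
  (∫ δ, F δ ∂μ)⁻¹ • ∫ δ, F δ • δ ∂μ

lemma norm_weightedMean_le (hD : 0 ≤ D) (hF0 : ∀ δ, 0 ≤ F δ)
    (hFD : ∀ δ, F δ ≠ 0 → ‖δ‖ ≤ D) : ‖weightedMean μ F‖ ≤ D := by
  by_cases hF : Integrable F μ
  · have hnum : ‖∫ δ, F δ • δ ∂μ‖ ≤ (∫ δ, F δ ∂μ) * D := by
      rw [← integral_mul_const]
      refine norm_integral_le_of_norm_le (hF.mul_const D) (Eventually.of_forall fun δ => ?_)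
      simpa only [abs_of_nonneg (hF0 δ)] using norm_smul_self_le hFD δ
    have hden : 0 ≤ ∫ δ, F δ ∂μ := integral_nonneg hF0
    rw [weightedMean, norm_smul, norm_inv, Real.norm_of_nonneg hden]
    exact inv_mul_le_of_le_mul₀ hden hD hnum
  · simpa [weightedMean, integral_undef hF] using hD

lemma weightedMean_mem [CompleteSpace E] {S : Set E} (hSc : Convex ℝ S) (hS : IsClosed S)
    (hF : Integrable F μ) (hF0 : ∀ δ, 0 ≤ F δ) (hFS : ∀ δ, F δ ≠ 0 → δ ∈ S)
    (hFδ : Integrable (fun δ => F δ • δ) μ) (hpos : 0 < ∫ δ, F δ ∂μ) :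
    weightedMean μ F ∈ S := by
  set ν := μ.withDensity fun δ => ENNReal.ofReal (F δ) with hν
  have hFm : AEMeasurable (fun δ => ENNReal.ofReal (F δ)) μ := hF.aemeasurable.ennreal_ofReal
  have hfin : ∀ᵐ δ ∂μ, ENNReal.ofReal (F δ) < ⊤ := by simp
  have htoReal : ∀ δ, (ENNReal.ofReal (F δ)).toReal = F δ := fun δ => ENNReal.toReal_ofReal (hF0 δ)
  have hνuniv : ν univ = ENNReal.ofReal (∫ δ, F δ ∂μ) := by
    rw [hν, withDensity_apply _ MeasurableSet.univ, Measure.restrict_univ,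
      ofReal_integral_eq_lintegral_ofReal hF (Eventually.of_forall hF0)]
  have : IsFiniteMeasure ν := ⟨by simp [hνuniv]⟩
  have : NeZero ν := ⟨fun h => by simp [h, hpos.not_ge] at hνuniv⟩
  have hmem : ∀ᵐ δ ∂ν, δ ∈ S := by
    rw [hν, ae_withDensity_iff' hFm]
    refine Eventually.of_forall fun δ hδ => hFS δ fun h => hδ (by simp [h])
  have hint : Integrable (fun δ => δ) ν := by
    rw [hν, integrable_withDensity_iff_integrable_smul₀' hFm hfin]
    simpa only [htoReal] using hFδ
  have hmean : ⨍ δ, δ ∂ν = weightedMean μ F := by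
    rw [average_eq, measureReal_def, hνuniv, ENNReal.toReal_ofReal hpos.le, hν,
      integral_withDensity_eq_integral_toReal_smul₀ hFm hfin]
    simp only [htoReal, weightedMean]
  exact hmean ▸ hSc.average_mem hS hmem hint

variable [BorelSpace E] [SecondCountableTopology E]

lemma integrable_smul_self (hF : Integrable F μ) (hFD : ∀ δ, F δ ≠ 0 → ‖δ‖ ≤ D) :
    Integrable (fun δ => F δ • δ) μ :=
  (hF.abs.mul_const D).mono' (hF.aestronglyMeasurable.smul aestronglyMeasurable_id)
    (Eventually.of_forall (norm_smul_self_le hFD))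

lemma norm_weightedMean_sub_le [CompleteSpace E] (hD : 0 ≤ D) (hF : Integrable F μ)
    (hG : Integrable G μ) (hF0 : ∀ δ, 0 ≤ F δ) (hFD : ∀ δ, F δ ≠ 0 → ‖δ‖ ≤ D)
    (hGD : ∀ δ, G δ ≠ 0 → ‖δ‖ ≤ D)
    (hFpos : 0 < ∫ δ, F δ ∂μ) (hGpos : 0 < ∫ δ, G δ ∂μ) :
    ‖weightedMean μ G - weightedMean μ F‖ ≤ 2 * D * (∫ δ, |G δ - F δ| ∂μ) / ∫ δ, G δ ∂μ := by
  set m := weightedMean μ F with hm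
  have hmD : ‖m‖ ≤ D := norm_weightedMean_le hD hF0 hFD
  have iF := integrable_smul_self hF hFD
  have iG := integrable_smul_self hG hGD
  have hFm : ∫ δ, F δ • δ ∂μ = (∫ δ, F δ ∂μ) • m := by
    rw [hm, weightedMean, smul_smul, mul_inv_cancel₀ hFpos.ne', one_smul]
  have hdiff : ∫ δ, (G δ - F δ) • (δ - m) ∂μ = (∫ δ, G δ • δ ∂μ) - (∫ δ, G δ ∂μ) • m := by
    have hexpand : ∀ δ, (G δ - F δ) • (δ - m) = (G δ • δ - F δ • δ) - (G δ - F δ) • m :=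
      fun δ => by module
    simp only [hexpand]
    calc ∫ δ, (G δ • δ - F δ • δ) - (G δ - F δ) • m ∂μ
        = ((∫ δ, G δ • δ ∂μ) - ∫ δ, F δ • δ ∂μ) - ((∫ δ, G δ ∂μ) - ∫ δ, F δ ∂μ) • m := by
          rw [integral_sub (by fun_prop) (by fun_prop), integral_sub iG iF, integral_smul_const,
            integral_sub hG hF]
      _ = (∫ δ, G δ • δ ∂μ) - (∫ δ, G δ ∂μ) • m := by rw [hFm]; module
  have hmean : weightedMean μ G - m = (∫ δ, G δ ∂μ)⁻¹ • ∫ δ, (G δ - F δ) • (δ - m) ∂μ := by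
    rw [hdiff, weightedMean, smul_sub, smul_smul, inv_mul_cancel₀ hGpos.ne', one_smul]
  rw [hmean, norm_smul, norm_inv, Real.norm_of_nonneg hGpos.le, div_eq_inv_mul,
    ← integral_const_mul]
  refine mul_le_mul_of_nonneg_left ?_ (inv_nonneg.2 hGpos.le)
  refine norm_integral_le_of_norm_le ((hG.sub hF).abs.const_mul _)
    (Eventually.of_forall fun δ => ?_)
  rw [norm_smul, Real.norm_eq_abs, mul_comm]
  by_cases hδ : ‖δ‖ ≤ D
  · exact mul_le_mul_of_nonneg_right ((norm_sub_le _ _).trans (by linarith)) (abs_nonneg _)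
  · have hF' : F δ = 0 := not_not.1 (mt (hFD δ) hδ)
    have hG' : G δ = 0 := not_not.1 (mt (hGD δ) hδ)
    simp [hF', hG']

end WeightedMean

section BoundedPair

variable {d : ℕ} {Ω : Set (Pt d)} {lo hi : ℝ} {p₀ p₁ : Pt d → ℝ}

/-- A pair of positive functions on `Ω` with two-sided bounds, without any regularity. -/
structure IsBoundedPair (Ω : Set (Pt d)) (lo hi : ℝ) (p₀ p₁ : Pt d → ℝ) : Prop where
  lo_pos : 0 < lo
  mem_Icc₀ : ∀ x ∈ Ω, p₀ x ∈ Icc lo hi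
  mem_Icc₁ : ∀ x ∈ Ω, p₁ x ∈ Icc lo hi

lemma abs_div_sub_one_le_of_mem_Icc {a b : ℝ} (hlo : 0 < lo) (ha : a ∈ Icc lo hi)
    (hb : b ∈ Icc lo hi) : |a / b - 1| ≤ hi / lo := by
  have hnonneg : 0 ≤ a / b := div_nonneg (hlo.le.trans ha.1) (hlo.le.trans hb.1)
  have hle : a / b ≤ hi / lo := div_le_div₀ (hlo.le.trans (ha.1.trans ha.2)) ha.2 hlo hb.1
  have hone : 1 ≤ hi / lo := (one_le_div hlo).2 (ha.1.trans ha.2)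
  rw [abs_le]
  constructor <;> linarith

lemma IsBoundedPair.max_ratio_le (h : IsBoundedPair Ω lo hi p₀ p₁) {z z' : Pt d} (hz : z ∈ Ω)
    (hz' : z' ∈ Ω) : max |p₀ z / p₀ z' - 1| |p₁ z / p₁ z' - 1| ≤ hi / lo :=
  max_le (abs_div_sub_one_le_of_mem_Icc h.lo_pos (h.mem_Icc₀ z hz) (h.mem_Icc₀ z' hz'))
    (abs_div_sub_one_le_of_mem_Icc h.lo_pos (h.mem_Icc₁ z hz) (h.mem_Icc₁ z' hz'))

lemma ratioModulus_nonneg (Ω : Set (Pt d)) (p₀ p₁ : Pt d → ℝ) (η : ℝ) :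
    0 ≤ ratioModulus Ω p₀ p₁ η := by
  refine Real.sSup_nonneg ?_
  rintro r ⟨z, -, z', -, -, rfl⟩
  exact (abs_nonneg _).trans (le_max_left _ _)

lemma ratioModulus_le {η M : ℝ} (hM : 0 ≤ M)
    (h : ∀ z ∈ Ω, ∀ z' ∈ Ω, ‖z - z'‖ ≤ η → max |p₀ z / p₀ z' - 1| |p₁ z / p₁ z' - 1| ≤ M) :
    ratioModulus Ω p₀ p₁ η ≤ M := by
  refine Real.sSup_le ?_ hM
  rintro r ⟨z, hz, z', hz', hη, rfl⟩
  exact h z hz z' hz' hη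

namespace IsBoundedPair

lemma ratio_le_ratioModulus (h : IsBoundedPair Ω lo hi p₀ p₁) {z z' : Pt d} (hz : z ∈ Ω)
    (hz' : z' ∈ Ω) {η : ℝ} (hη : ‖z - z'‖ ≤ η) :
    max |p₀ z / p₀ z' - 1| |p₁ z / p₁ z' - 1| ≤ ratioModulus Ω p₀ p₁ η := by
  refine le_csSup ⟨hi / lo, ?_⟩ ⟨z, hz, z', hz', hη, rfl⟩
  rintro r ⟨x, hx, x', hx', -, rfl⟩
  exact h.max_ratio_le hx hx'

lemma abs_div_sub_one_le₀ (h : IsBoundedPair Ω lo hi p₀ p₁) {z z' : Pt d} (hz : z ∈ Ω)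
    (hz' : z' ∈ Ω) {η : ℝ} (hη : ‖z - z'‖ ≤ η) :
    |p₀ z / p₀ z' - 1| ≤ ratioModulus Ω p₀ p₁ η :=
  (le_max_left _ _).trans (h.ratio_le_ratioModulus hz hz' hη)

lemma abs_div_sub_one_le₁ (h : IsBoundedPair Ω lo hi p₀ p₁) {z z' : Pt d} (hz : z ∈ Ω)
    (hz' : z' ∈ Ω) {η : ℝ} (hη : ‖z - z'‖ ≤ η) :
    |p₁ z / p₁ z' - 1| ≤ ratioModulus Ω p₀ p₁ η :=
  (le_max_right _ _).trans (h.ratio_le_ratioModulus hz hz' hη)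

lemma monotone_ratioModulus (h : IsBoundedPair Ω lo hi p₀ p₁) :
    Monotone (ratioModulus Ω p₀ p₁) := fun _ _ hab =>
  ratioModulus_le (ratioModulus_nonneg _ _ _ _) fun _ hz _ hz' hη =>
    h.ratio_le_ratioModulus hz hz' (hη.trans hab)

lemma ratioModulus_le_div (h : IsBoundedPair Ω lo hi p₀ p₁) (hne : Ω.Nonempty) (η : ℝ) :
    ratioModulus Ω p₀ p₁ η ≤ hi / lo := by
  obtain ⟨x, hx⟩ := hne
  have hhi : 0 ≤ hi := h.lo_pos.le.trans ((h.mem_Icc₀ x hx).1.trans (h.mem_Icc₀ x hx).2)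
  exact ratioModulus_le (div_nonneg hhi h.lo_pos.le) fun _ hz _ hz' _ => h.max_ratio_le hz hz'

end IsBoundedPair

lemma exists_mem_dist_le_dist_le {E : Type*} [NormedAddCommGroup E] [NormedSpace ℝ E]
    {s : Set E} (hs : Convex ℝ s) {x y : E} (hx : x ∈ s) (hy : y ∈ s) {a b : ℝ} (ha : 0 < a)
    (hb : 0 ≤ b) (hxy : dist x y ≤ a + b) : ∃ w ∈ s, dist x w ≤ a ∧ dist w y ≤ b := by
  have hab : 0 < a + b := by linarith
  have hc : 1 - a / (a + b) = b / (a + b) := by field_simp; ring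
  refine ⟨AffineMap.lineMap x y (a / (a + b)), hs.lineMap_mem hx hy ⟨by positivity, ?_⟩, ?_, ?_⟩
  · rw [div_le_one hab]; linarith
  · rw [dist_left_lineMap, Real.norm_of_nonneg (by positivity), div_mul_eq_mul_div,
      div_le_iff₀ hab]
    exact mul_le_mul_of_nonneg_left hxy ha.le
  · rw [dist_lineMap_right, hc, Real.norm_of_nonneg (by positivity), div_mul_eq_mul_div,
      div_le_iff₀ hab]
    exact mul_le_mul_of_nonneg_left hxy hb

lemma abs_mul_sub_one_le {r s a b : ℝ} (hr : |r - 1| ≤ a) (hs : |s - 1| ≤ b) :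
    |r * s - 1| ≤ (1 + a) * (1 + b) - 1 := by
  have ha : 0 ≤ a := (abs_nonneg _).trans hr
  calc |r * s - 1| = |(r - 1) * (s - 1) + (r - 1) + (s - 1)| := by ring_nf
    _ ≤ |r - 1| * |s - 1| + |r - 1| + |s - 1| := by rw [← abs_mul]; exact abs_add_three _ _ _
    _ ≤ a * b + a + b := by gcongr
    _ = (1 + a) * (1 + b) - 1 := by ring

lemma abs_div_sub_one_le_of_div {x y w a b : ℝ} (hw : w ≠ 0) (ha : |x / w - 1| ≤ a)
    (hb : |w / y - 1| ≤ b) : |x / y - 1| ≤ (1 + a) * (1 + b) - 1 := by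
  rw [← div_mul_div_cancel₀ hw]
  exact abs_mul_sub_one_le ha hb

namespace IsBoundedPair

lemma ratioModulus_add_le (h : IsBoundedPair Ω lo hi p₀ p₁) (hc : Convex ℝ Ω) {a b : ℝ}
    (ha : 0 < a) (hb : 0 ≤ b) :
    ratioModulus Ω p₀ p₁ (a + b) ≤
      (1 + ratioModulus Ω p₀ p₁ a) * (1 + ratioModulus Ω p₀ p₁ b) - 1 := by
  have hωa := ratioModulus_nonneg Ω p₀ p₁ a
  have hωb := ratioModulus_nonneg Ω p₀ p₁ b
  refine ratioModulus_le (by nlinarith) fun z hz z' hz' hη => ?_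
  obtain ⟨w, hw, hzw, hwz'⟩ :=
    exists_mem_dist_le_dist_le hc hz hz' ha hb (by rwa [dist_eq_norm])
  rw [dist_eq_norm] at hzw hwz'
  exact max_le
    (abs_div_sub_one_le_of_div (h.lo_pos.trans_le (h.mem_Icc₀ w hw).1).ne'
      (h.abs_div_sub_one_le₀ hz hw hzw) (h.abs_div_sub_one_le₀ hw hz' hwz'))
    (abs_div_sub_one_le_of_div (h.lo_pos.trans_le (h.mem_Icc₁ w hw).1).ne'
      (h.abs_div_sub_one_le₁ hz hw hzw) (h.abs_div_sub_one_le₁ hw hz' hwz'))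

lemma ratioModulus_sub_le (h : IsBoundedPair Ω lo hi p₀ p₁) (hc : Convex ℝ Ω)
    (hne : Ω.Nonempty) {a b : ℝ} (ha : 0 < a) (hab : a ≤ b) :
    ratioModulus Ω p₀ p₁ b - ratioModulus Ω p₀ p₁ a ≤
      (1 + hi / lo) * ratioModulus Ω p₀ p₁ (b - a) := by
  have hadd := h.ratioModulus_add_le hc ha (sub_nonneg.2 hab)
  rw [add_sub_cancel] at hadd
  have hmul := mul_le_mul_of_nonneg_right (h.ratioModulus_le_div hne a)
    (ratioModulus_nonneg Ω p₀ p₁ (b - a))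
  linarith

end IsBoundedPair

end BoundedPair

section Modulus

variable {ω : ℝ → ℝ}

/-- What the Osgood argument uses of a modulus of continuity `ω`; nothing is required at `0`. -/
structure IsOsgoodModulus (ω : ℝ → ℝ) : Prop where
  nonneg : ∀ u, 0 ≤ ω u
  mono : Monotone ω
  continuousOn : ContinuousOn ω (Ioi 0)
  bounded : ∃ M, ∀ u, ω u ≤ M
  osgood : IsOsgood ω

lemma continuousOn_Ioi_of_sub_le {c : ℝ} (hmono : Monotone ω)
    (hω : Tendsto ω (𝓝[>] 0) (𝓝 0))
    (hsub : ∀ a b, 0 < a → a ≤ b → ω b - ω a ≤ c * ω (b - a)) : ContinuousOn ω (Ioi 0) := by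
  intro a (ha : 0 < a)
  refine ContinuousAt.continuousWithinAt (continuousAt_iff_punctured_nhds.2 ?_)
  have habs : Tendsto (fun b => |b - a|) (𝓝[≠] a) (𝓝[>] 0) :=
    tendsto_nhdsWithin_iff.2
      ⟨((continuous_id.sub continuous_const).abs.tendsto' a 0 (by simp)).mono_left
        nhdsWithin_le_nhds,
      eventually_nhdsWithin_of_forall fun b hb => abs_pos.2 (sub_ne_zero.2 hb)⟩
  have hlim : Tendsto (fun b => c * ω |b - a|) (𝓝[≠] a) (𝓝 0) := by
    simpa using (hω.comp habs).const_mul c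
  rw [tendsto_iff_norm_sub_tendsto_zero]
  refine squeeze_zero' (Eventually.of_forall fun _ => norm_nonneg _) ?_ hlim
  filter_upwards [nhdsWithin_le_nhds (lt_mem_nhds ha)] with b hb
  rw [Real.norm_eq_abs]
  rcases le_total a b with hab | hab
  · rw [abs_of_nonneg (sub_nonneg.2 (hmono hab)), abs_of_nonneg (sub_nonneg.2 hab)]
    exact hsub a b ha hab
  · rw [abs_sub_comm, abs_sub_comm b, abs_of_nonneg (sub_nonneg.2 (hmono hab)),
      abs_of_nonneg (sub_nonneg.2 hab)]
    exact hsub b a hb hab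

lemma continuousOn_of_abs_div_sub_one_le {E : Type*} [NormedAddCommGroup E] {s : Set E}
    {p : E → ℝ} (hp : ∀ x ∈ s, p x ≠ 0) (hω : Tendsto ω (𝓝[>] 0) (𝓝 0))
    (hratio : ∀ x ∈ s, ∀ y ∈ s, |p x / p y - 1| ≤ ω ‖x - y‖) : ContinuousOn p s := by
  intro a ha
  rw [← continuousWithinAt_sdiff_self]
  have hnorm : Tendsto (fun x => ‖x - a‖) (𝓝[s \ {a}] a) (𝓝[>] 0) :=
    tendsto_nhdsWithin_iff.2
      ⟨((continuous_id.sub continuous_const).norm.tendsto' a 0 (by simp)).mono_left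
        nhdsWithin_le_nhds,
      eventually_nhdsWithin_of_forall fun x hx => norm_pos_iff.2 (sub_ne_zero.2 hx.2)⟩
  have hlim : Tendsto (fun x => ω ‖x - a‖ * |p a|) (𝓝[s \ {a}] a) (𝓝 0) := by
    simpa using (hω.comp hnorm).mul_const |p a|
  refine tendsto_iff_norm_sub_tendsto_zero.2
    (squeeze_zero' (Eventually.of_forall fun _ => norm_nonneg _) ?_ hlim)
  filter_upwards [self_mem_nhdsWithin] with x hx
  calc ‖p x - p a‖ = |p x / p a - 1| * |p a| := by
        rw [← abs_mul, sub_mul, div_mul_cancel₀ _ (hp a ha), one_mul, Real.norm_eq_abs]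
    _ ≤ ω ‖x - a‖ * |p a| := by gcongr; exact hratio x hx.1 a ha

lemma IsOsgood.exists_lt (h : IsOsgood ω) (hmono : Monotone ω) (hnonneg : ∀ u, 0 ≤ ω u) {c : ℝ}
    (hc : 0 < c) : ∃ s > 0, ω s < c := by
  by_contra! hge
  obtain ⟨u, hpsi, hu0, hu1⟩ := ((h.eventually (eventually_lt_atBot (-(1 / c)))).and
    (Ioo_mem_nhdsGT (zero_lt_one' ℝ))).exists
  have hle : ∫ s in u..1, 1 / (s + ω s) ≤ ∫ s in u..1, 1 / c := by
    refine intervalIntegral.integral_mono_on hu1.le (AntitoneOn.intervalIntegrable ?_) (by simp)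
      fun s hs => ?_
    · rw [uIcc_of_le hu1.le]
      intro a ha b _ hab
      exact one_div_le_one_div_of_le (by linarith [hu0.trans_le ha.1, hnonneg a])
        (by linarith [hmono hab])
    · have hs0 : 0 < s := hu0.trans_le hs.1
      exact one_div_le_one_div_of_le hc (by linarith [hge s hs0])
  rw [psiReal, intervalIntegral.integral_symm] at hpsi
  rw [intervalIntegral.integral_const, smul_eq_mul] at hle
  have hlen : (1 - u) * (1 / c) ≤ 1 / c := mul_le_of_le_one_left (by positivity) (by linarith)
  linarith

lemma IsOsgood.tendsto_zero (h : IsOsgood ω) (hmono : Monotone ω) (hnonneg : ∀ u, 0 ≤ ω u) :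
    Tendsto ω (𝓝[>] 0) (𝓝 0) := by
  refine tendsto_order.2 ⟨fun c hc => Eventually.of_forall fun u => hc.trans_le (hnonneg u),
    fun c hc => ?_⟩
  obtain ⟨s, hs, hsc⟩ := h.exists_lt hmono hnonneg hc
  filter_upwards [Ioo_mem_nhdsGT hs] with u hu
  exact (hmono hu.2.le).trans_lt hsc

end Modulus

section WeightPair

variable {d : ℕ} {Ω : Set (Pt d)} {lo hi : ℝ} {p₀ p₁ : Pt d → ℝ}

/-- A bounded pair of positive functions that are moreover continuous on `Ω`. -/
structure IsWeightPair (Ω : Set (Pt d)) (lo hi : ℝ) (p₀ p₁ : Pt d → ℝ) : Prop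
    extends IsBoundedPair Ω lo hi p₀ p₁ where
  continuousOn₀ : ContinuousOn p₀ Ω
  continuousOn₁ : ContinuousOn p₁ Ω

namespace IsBoundedPair

lemma isOsgoodModulus (h : IsBoundedPair Ω lo hi p₀ p₁) (hc : Convex ℝ Ω) (hne : Ω.Nonempty)
    (ho : IsOsgood (ratioModulus Ω p₀ p₁)) : IsOsgoodModulus (ratioModulus Ω p₀ p₁) where
  nonneg := ratioModulus_nonneg Ω p₀ p₁
  mono := h.monotone_ratioModulus
  continuousOn := continuousOn_Ioi_of_sub_le h.monotone_ratioModulus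
    (ho.tendsto_zero h.monotone_ratioModulus (ratioModulus_nonneg Ω p₀ p₁))
    fun _ _ ha hab => h.ratioModulus_sub_le hc hne ha hab
  bounded := ⟨hi / lo, h.ratioModulus_le_div hne⟩
  osgood := ho

lemma isWeightPair (h : IsBoundedPair Ω lo hi p₀ p₁) (ho : IsOsgood (ratioModulus Ω p₀ p₁)) :
    IsWeightPair Ω lo hi p₀ p₁ := by
  have hω := ho.tendsto_zero h.monotone_ratioModulus (ratioModulus_nonneg Ω p₀ p₁)
  exact
    { toIsBoundedPair := h
      continuousOn₀ := continuousOn_of_abs_div_sub_one_le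
        (fun x hx => (h.lo_pos.trans_le (h.mem_Icc₀ x hx).1).ne') hω
        fun _ hz _ hz' => h.abs_div_sub_one_le₀ hz hz' le_rfl
      continuousOn₁ := continuousOn_of_abs_div_sub_one_le
        (fun x hx => (h.lo_pos.trans_le (h.mem_Icc₁ x hx).1).ne') hω
        fun _ hz _ hz' => h.abs_div_sub_one_le₁ hz hz' le_rfl }

end IsBoundedPair

end WeightPair

section Admissible

variable {d : ℕ} {Ω : Set (Pt d)} {t ρ : ℝ} {z δ : Pt d}

lemma isClosed_admissible (hΩ : IsClosed Ω) (t : ℝ) (z : Pt d) : IsClosed (admissible Ω t z) :=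
  (hΩ.preimage (by fun_prop : Continuous fun δ : Pt d => z - t • δ)).inter
    (hΩ.preimage (by fun_prop : Continuous fun δ : Pt d => z + (1 - t) • δ))

lemma convex_admissible (hΩ : Convex ℝ Ω) (t : ℝ) (z : Pt d) :
    Convex ℝ (admissible Ω t z) := by
  intro a ha b hb r s hr hs hrs
  obtain rfl : s = 1 - r := by linarith
  constructor
  · convert hΩ ha.1 hb.1 hr hs hrs using 1
    module
  · convert hΩ ha.2 hb.2 hr hs hrs using 1
    module

lemma norm_le_of_mem_admissible (hΩ : Bornology.IsBounded Ω) (h : δ ∈ admissible Ω t z) :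
    ‖δ‖ ≤ Metric.diam Ω := by
  have hδ : δ = (z + (1 - t) • δ) - (z - t • δ) := by module
  rw [hδ, ← dist_eq_norm]
  exact Metric.dist_le_diam_of_mem hΩ h.2 h.1

lemma isCompact_admissible (hΩ : IsCompact Ω) (t : ℝ) (z : Pt d) :
    IsCompact (admissible Ω t z) :=
  Metric.isCompact_of_isClosed_isBounded (isClosed_admissible hΩ.isClosed t z)
    (isBounded_iff_forall_norm_le.2
      ⟨Metric.diam Ω, fun _ h => norm_le_of_mem_admissible hΩ.isBounded h⟩)

lemma closedBall_subset_admissible (h : Metric.closedBall z ρ ⊆ Ω) (ht : t ∈ Icc (0 : ℝ) 1) :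
    Metric.closedBall 0 ρ ⊆ admissible Ω t z := by
  intro δ hδ
  rw [mem_closedBall_zero_iff] at hδ
  constructor <;> refine h (mem_closedBall_iff_norm.2 ?_)
  · rw [sub_sub_cancel_left, norm_neg, norm_smul, Real.norm_of_nonneg ht.1]
    exact (mul_le_of_le_one_left (norm_nonneg δ) ht.2).trans hδ
  · rw [add_sub_cancel_left, norm_smul, Real.norm_of_nonneg (sub_nonneg.2 ht.2)]
    exact (mul_le_of_le_one_left (norm_nonneg δ) (by linarith [ht.1])).trans hδ

lemma volume_admissible_pos (hΩ : IsCompact Ω) (ht : t ∈ Icc (0 : ℝ) 1)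
    (hz : z ∈ interior Ω) : 0 < volume.real (admissible Ω t z) := by
  obtain ⟨ρ, hρ, hball⟩ := Metric.nhds_basis_closedBall.mem_iff.1 (mem_interior_iff_mem_nhds.1 hz)
  have hpos := (Metric.measure_closedBall_pos volume (0 : Pt d) hρ).trans_le
    (measure_mono (closedBall_subset_admissible hball ht))
  exact ENNReal.toReal_pos hpos.ne' (isCompact_admissible hΩ t z).measure_lt_top.ne

end Admissible

section Weight

variable {d : ℕ} {Ω : Set (Pt d)} {lo hi : ℝ} {p₀ p₁ : Pt d → ℝ} {t : ℝ} {z δ : Pt d}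

/-- The density of the displacement `X₁ - X₀` given `X_t = z`, up to normalisation. Extending `p₀`
and `p₁` by zero makes it a function on the whole space that vanishes off `admissible Ω t z`. -/
noncomputable def weight (Ω : Set (Pt d)) (p₀ p₁ : Pt d → ℝ) (t : ℝ) (z δ : Pt d) : ℝ :=
  Ω.indicator p₀ (z - t • δ) * Ω.indicator p₁ (z + (1 - t) • δ)

lemma weight_of_mem (h : δ ∈ admissible Ω t z) :
    weight Ω p₀ p₁ t z δ = p₀ (z - t • δ) * p₁ (z + (1 - t) • δ) := by
  simp [weight, h.1, h.2]

lemma weight_of_notMem (h : δ ∉ admissible Ω t z) : weight Ω p₀ p₁ t z δ = 0 := by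
  by_cases h₀ : z - t • δ ∈ Ω
  · have h₁ : z + (1 - t) • δ ∉ Ω := fun h₁ => h ⟨h₀, h₁⟩
    simp [weight, h₁]
  · simp [weight, h₀]

lemma mem_admissible_of_weight_ne_zero (h : weight Ω p₀ p₁ t z δ ≠ 0) :
    δ ∈ admissible Ω t z :=
  not_not.1 (mt weight_of_notMem h)

lemma norm_le_of_weight_ne_zero (hΩ : Bornology.IsBounded Ω)
    (h : weight Ω p₀ p₁ t z δ ≠ 0) : ‖δ‖ ≤ Metric.diam Ω :=
  norm_le_of_mem_admissible hΩ (mem_admissible_of_weight_ne_zero h)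

lemma velocity_eq_weightedMean (hΩ : IsCompact Ω) (p₀ p₁ : Pt d → ℝ) (t : ℝ) (z : Pt d) :
    velocity Ω p₀ p₁ t z = weightedMean volume (weight Ω p₀ p₁ t z) := by
  have hS := (isCompact_admissible hΩ t z).measurableSet
  have hden : ∫ δ in admissible Ω t z, p₀ (z - t • δ) * p₁ (z + (1 - t) • δ)
      = ∫ δ, weight Ω p₀ p₁ t z δ := by
    rw [← setIntegral_eq_integral_of_forall_compl_eq_zero fun _ h => weight_of_notMem h]
    exact setIntegral_congr_fun hS fun _ h => (weight_of_mem h).symm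
  have hnum : ∫ δ in admissible Ω t z, (p₀ (z - t • δ) * p₁ (z + (1 - t) • δ)) • δ
      = ∫ δ, weight Ω p₀ p₁ t z δ • δ := by
    have hoff : ∀ δ ∉ admissible Ω t z, weight Ω p₀ p₁ t z δ • δ = 0 := fun δ h => by
      rw [weight_of_notMem h, zero_smul]
    rw [← setIntegral_eq_integral_of_forall_compl_eq_zero hoff]
    exact setIntegral_congr_fun hS fun _ h => congrArg (· • _) (weight_of_mem h).symm
  rw [velocity, weightedMean, hden, hnum]

lemma measurable_indicator_of_continuousOn (hΩ : MeasurableSet Ω) {p : Pt d → ℝ}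
    (hp : ContinuousOn p Ω) : Measurable (Ω.indicator p) := by
  classical
  rw [← piecewise_eq_indicator]
  exact hp.measurable_piecewise continuousOn_const hΩ

lemma measurable_weight (hΩ : MeasurableSet Ω) (hp₀ : ContinuousOn p₀ Ω)
    (hp₁ : ContinuousOn p₁ Ω) :
    Measurable fun q : (ℝ × Pt d) × Pt d => weight Ω p₀ p₁ q.1.1 q.1.2 q.2 := by
  have h₀ := measurable_indicator_of_continuousOn hΩ hp₀
  have h₁ := measurable_indicator_of_continuousOn hΩ hp₁
  unfold weight
  fun_prop

namespace IsBoundedPair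

lemma weight_mem_Icc (h : IsBoundedPair Ω lo hi p₀ p₁) (hδ : δ ∈ admissible Ω t z) :
    weight Ω p₀ p₁ t z δ ∈ Icc (lo ^ 2) (hi ^ 2) := by
  have hlo := h.lo_pos.le
  have h₀ := h.mem_Icc₀ _ hδ.1
  have h₁ := h.mem_Icc₁ _ hδ.2
  rw [weight_of_mem hδ, sq, sq]
  exact ⟨mul_le_mul h₀.1 h₁.1 hlo (hlo.trans h₀.1),
    mul_le_mul h₀.2 h₁.2 (hlo.trans h₁.1) (hlo.trans (h₀.1.trans h₀.2))⟩

lemma weight_nonneg (h : IsBoundedPair Ω lo hi p₀ p₁) (t : ℝ) (z δ : Pt d) :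
    0 ≤ weight Ω p₀ p₁ t z δ :=
  mul_nonneg (indicator_nonneg (fun x hx => h.lo_pos.le.trans (h.mem_Icc₀ x hx).1) _)
    (indicator_nonneg (fun x hx => h.lo_pos.le.trans (h.mem_Icc₁ x hx).1) _)

lemma norm_velocity_le (h : IsBoundedPair Ω lo hi p₀ p₁) (hΩ : IsCompact Ω) (t : ℝ)
    (z : Pt d) : ‖velocity Ω p₀ p₁ t z‖ ≤ Metric.diam Ω := by
  rw [velocity_eq_weightedMean hΩ]
  exact norm_weightedMean_le Metric.diam_nonneg (h.weight_nonneg t z)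
    fun _ => norm_le_of_weight_ne_zero hΩ.isBounded

end IsBoundedPair

namespace IsWeightPair

lemma integrable_weight (h : IsWeightPair Ω lo hi p₀ p₁) (hΩ : IsCompact Ω) (t : ℝ)
    (z : Pt d) : Integrable (weight Ω p₀ p₁ t z) := by
  have hS := isCompact_admissible hΩ t z
  have hmeas : Measurable (weight Ω p₀ p₁ t z) :=
    (measurable_weight hΩ.measurableSet h.continuousOn₀ h.continuousOn₁).comp
      (measurable_prodMk_left (x := (t, z)))
  rw [← integrableOn_iff_integrable_of_support_subset
    fun _ => mem_admissible_of_weight_ne_zero (p₀ := p₀) (p₁ := p₁)]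
  refine IntegrableOn.of_bound hS.measure_lt_top hmeas.aestronglyMeasurable (hi ^ 2) ?_
  filter_upwards [ae_restrict_mem hS.measurableSet] with δ hδ
  rw [Real.norm_of_nonneg (h.weight_nonneg t z δ)]
  exact (h.weight_mem_Icc hδ).2

lemma mul_volume_le_integral_weight (h : IsWeightPair Ω lo hi p₀ p₁) (hΩ : IsCompact Ω)
    (t : ℝ) (z : Pt d) :
    lo ^ 2 * volume.real (admissible Ω t z) ≤ ∫ δ, weight Ω p₀ p₁ t z δ := by
  have hS := isCompact_admissible hΩ t z
  rw [← setIntegral_eq_integral_of_forall_compl_eq_zero fun _ h => weight_of_notMem h]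
  calc lo ^ 2 * volume.real (admissible Ω t z) = ∫ _ in admissible Ω t z, lo ^ 2 := by
        rw [setIntegral_const, smul_eq_mul, mul_comm]
    _ ≤ ∫ δ in admissible Ω t z, weight Ω p₀ p₁ t z δ :=
        setIntegral_mono_on (integrableOn_const hS.measure_lt_top.ne)
          (h.integrable_weight hΩ t z).integrableOn hS.measurableSet
          fun _ hδ => (h.weight_mem_Icc hδ).1

lemma integral_weight_pos (h : IsWeightPair Ω lo hi p₀ p₁) (hΩ : IsCompact Ω)
    (ht : t ∈ Icc (0 : ℝ) 1) (hz : z ∈ interior Ω) : 0 < ∫ δ, weight Ω p₀ p₁ t z δ :=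
  (mul_pos (pow_pos h.lo_pos 2) (volume_admissible_pos hΩ ht hz)).trans_le
    (h.mul_volume_le_integral_weight hΩ t z)

lemma measurable_velocity (h : IsWeightPair Ω lo hi p₀ p₁) (hΩ : IsCompact Ω) :
    Measurable fun q : ℝ × Pt d => velocity Ω p₀ p₁ q.1 q.2 := by
  have hw := measurable_weight hΩ.measurableSet h.continuousOn₀ h.continuousOn₁
  have hden : StronglyMeasurable fun q : ℝ × Pt d => ∫ δ, weight Ω p₀ p₁ q.1 q.2 δ :=
    hw.stronglyMeasurable.integral_prod_right
  have hnum : StronglyMeasurable fun q : ℝ × Pt d => ∫ δ, weight Ω p₀ p₁ q.1 q.2 δ • δ :=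
    (hw.smul measurable_snd).stronglyMeasurable.integral_prod_right
  simp only [velocity_eq_weightedMean hΩ]
  exact hden.measurable.inv.smul hnum.measurable

lemma velocity_mem_admissible (h : IsWeightPair Ω lo hi p₀ p₁) (hΩ : IsCompact Ω)
    (hc : Convex ℝ Ω) (ht : t ∈ Icc (0 : ℝ) 1) (hz : z ∈ interior Ω) :
    velocity Ω p₀ p₁ t z ∈ admissible Ω t z := by
  have hw := h.integrable_weight hΩ t z
  rw [velocity_eq_weightedMean hΩ]
  exact weightedMean_mem (convex_admissible hc t z) (isClosed_admissible hΩ.isClosed t z) hw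
    (h.weight_nonneg t z) (fun _ => mem_admissible_of_weight_ne_zero)
    (integrable_smul_self hw fun _ => norm_le_of_weight_ne_zero hΩ.isBounded)
    (h.integral_weight_pos hΩ ht hz)

end IsWeightPair

end Weight

section Perturbation

variable {d : ℕ} {Ω : Set (Pt d)} {lo hi lo' hi' : ℝ} {p₀ p₁ q₀ q₁ : Pt d → ℝ} {t : ℝ}

lemma abs_mul_sub_mul_le {a₀ a₁ b₀ b₁ c₀ c₁ : ℝ} (ha₀ : 0 < a₀) (ha₁ : 0 < a₁)
    (h₀ : |b₀ / a₀ - 1| ≤ c₀) (h₁ : |b₁ / a₁ - 1| ≤ c₁) :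
    |a₀ * a₁ - b₀ * b₁| ≤ ((1 + c₀) * (1 + c₁) - 1) * (a₀ * a₁) := by
  have hfactor : b₀ * b₁ - a₀ * a₁ = (b₀ / a₀ * (b₁ / a₁) - 1) * (a₀ * a₁) := by field_simp
  rw [abs_sub_comm, hfactor, abs_mul, abs_of_pos (mul_pos ha₀ ha₁)]
  exact mul_le_mul_of_nonneg_right (abs_mul_sub_one_le h₀ h₁) (mul_pos ha₀ ha₁).le

lemma abs_sub_one_le_of_abs_log_le {x r : ℝ} (hx : 0 < x) (h : |Real.log x| ≤ r) :
    |x - 1| ≤ Real.exp r - 1 := by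
  obtain ⟨hlower, hupper⟩ := abs_le.1 h
  have hle : x ≤ Real.exp r := (Real.log_le_iff_le_exp hx).1 hupper
  have hge : Real.exp (-r) ≤ x := (Real.le_log_iff_exp_le hx).1 hlower
  have hsymm : 2 ≤ Real.exp r + Real.exp (-r) := by
    have := Real.one_le_cosh r
    rw [Real.cosh_eq] at this
    linarith
  rw [abs_le]
  constructor <;> linarith

lemma norm_velocity_sub_velocity_le_of_integral_le (hp : IsWeightPair Ω lo hi p₀ p₁)
    (hq : IsWeightPair Ω lo' hi' q₀ q₁) (hΩ : IsCompact Ω) (ht : t ∈ Icc (0 : ℝ) 1) {z z' : Pt d}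
    (hz : z ∈ interior Ω) (hz' : z' ∈ interior Ω) {c : ℝ}
    (h : ∫ δ, |weight Ω p₀ p₁ t z' δ - weight Ω q₀ q₁ t z δ| ≤
      c * ∫ δ, weight Ω p₀ p₁ t z' δ) :
    ‖velocity Ω p₀ p₁ t z' - velocity Ω q₀ q₁ t z‖ ≤ 2 * Metric.diam Ω * c := by
  have hpos := hp.integral_weight_pos hΩ ht hz'
  rw [velocity_eq_weightedMean hΩ, velocity_eq_weightedMean hΩ]
  refine (norm_weightedMean_sub_le Metric.diam_nonneg (hq.integrable_weight hΩ t z)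
    (hp.integrable_weight hΩ t z') (hq.weight_nonneg t z)
    (fun _ => norm_le_of_weight_ne_zero hΩ.isBounded)
    (fun _ => norm_le_of_weight_ne_zero hΩ.isBounded)
    (hq.integral_weight_pos hΩ ht hz) hpos).trans ?_
  rw [mul_div_assoc]
  exact mul_le_mul_of_nonneg_left ((div_le_iff₀ hpos).2 h)
    (mul_nonneg zero_le_two Metric.diam_nonneg)

lemma abs_weight_sub_weight_le_of_logRatio_le {r : ℝ} (hp₀ : ∀ x ∈ Ω, 0 < p₀ x)
    (hp₁ : ∀ x ∈ Ω, 0 < p₁ x) (hq₀ : ∀ x ∈ Ω, 0 < q₀ x) (hq₁ : ∀ x ∈ Ω, 0 < q₁ x)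
    (hr : ∀ x ∈ Ω, logRatio p₀ p₁ q₀ q₁ x ≤ r) (z δ : Pt d) :
    |weight Ω p₀ p₁ t z δ - weight Ω q₀ q₁ t z δ| ≤
      (Real.exp (2 * r) - 1) * weight Ω p₀ p₁ t z δ := by
  by_cases h : δ ∈ admissible Ω t z
  · have hexp : Real.exp (2 * r) - 1 = (1 + (Real.exp r - 1)) * (1 + (Real.exp r - 1)) - 1 := by
      rw [two_mul, Real.exp_add]; ring
    rw [weight_of_mem h, weight_of_mem h, hexp]
    exact abs_mul_sub_mul_le (hp₀ _ h.1) (hp₁ _ h.2)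
      (abs_sub_one_le_of_abs_log_le (div_pos (hq₀ _ h.1) (hp₀ _ h.1))
        ((le_max_left _ _).trans (hr _ h.1)))
      (abs_sub_one_le_of_abs_log_le (div_pos (hq₁ _ h.2) (hp₁ _ h.2))
        ((le_max_right _ _).trans (hr _ h.2)))
  · simp [weight_of_notMem h]

lemma norm_velocity_sub_velocity_le {r : ℝ} (hp : IsWeightPair Ω lo hi p₀ p₁)
    (hq : IsWeightPair Ω lo' hi' q₀ q₁) (hr : ∀ x ∈ Ω, logRatio p₀ p₁ q₀ q₁ x ≤ r)
    (hΩ : IsCompact Ω) (ht : t ∈ Icc (0 : ℝ) 1) {z : Pt d} (hz : z ∈ interior Ω) :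
    ‖velocity Ω p₀ p₁ t z - velocity Ω q₀ q₁ t z‖ ≤
      2 * Metric.diam Ω * (Real.exp (2 * r) - 1) := by
  have iP := hp.integrable_weight hΩ t z
  refine norm_velocity_sub_velocity_le_of_integral_le hp hq hΩ ht hz hz ?_
  rw [← integral_const_mul]
  exact integral_mono (iP.sub (hq.integrable_weight hΩ t z)).abs (iP.const_mul _)
    (abs_weight_sub_weight_le_of_logRatio_le (fun x hx => hp.lo_pos.trans_le (hp.mem_Icc₀ x hx).1)
      (fun x hx => hp.lo_pos.trans_le (hp.mem_Icc₁ x hx).1)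
      (fun x hx => hq.lo_pos.trans_le (hq.mem_Icc₀ x hx).1)
      (fun x hx => hq.lo_pos.trans_le (hq.mem_Icc₁ x hx).1) hr z)

end Perturbation

section AdmissibleVolume

variable {d : ℕ} {Ω : Set (Pt d)} {t ρ l : ℝ} {z z' : Pt d}

lemma exists_mem_closedBall_eq_combo {E : Type*} [NormedAddCommGroup E] [NormedSpace ℝ E]
    {x y : E} (hρ : 0 ≤ ρ) (hl : 0 ≤ l) (hxy : ‖y - x‖ ≤ l * ρ) :
    ∃ w ∈ Metric.closedBall x ρ, (1 - l) • x + l • w = y := by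
  rcases hl.eq_or_lt with rfl | hl
  · rw [zero_mul, norm_le_zero_iff, sub_eq_zero] at hxy
    exact ⟨x, Metric.mem_closedBall_self hρ, by simp [hxy]⟩
  · refine ⟨x + l⁻¹ • (y - x), ?_, ?_⟩
    · rw [mem_closedBall_iff_norm, add_sub_cancel_left, norm_smul,
        Real.norm_of_nonneg (inv_nonneg.2 hl.le), inv_mul_le_iff₀ hl]
      exact hxy
    · rw [smul_add, smul_inv_smul₀ hl.ne']
      module

lemma smul_mem_admissible (hc : Convex ℝ Ω) (hz : Metric.closedBall z ρ ⊆ Ω) (hρ : 0 ≤ ρ)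
    (hl : l ∈ Icc (0 : ℝ) 1) (hzz' : ‖z' - z‖ ≤ l * ρ) {δ : Pt d} (hδ : δ ∈ admissible Ω t z) :
    (1 - l) • δ ∈ admissible Ω t z' := by
  obtain ⟨w, hw, rfl⟩ := exists_mem_closedBall_eq_combo hρ hl.1 hzz'
  constructor
  · convert hc hδ.1 (hz hw) (sub_nonneg.2 hl.2) hl.1 (sub_add_cancel 1 l) using 1
    module
  · convert hc hδ.2 (hz hw) (sub_nonneg.2 hl.2) hl.1 (sub_add_cancel 1 l) using 1
    module

open scoped Pointwise in
lemma pow_mul_volume_admissible_le (hΩ : IsCompact Ω) (hc : Convex ℝ Ω)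
    (hz : Metric.closedBall z ρ ⊆ Ω) (hρ : 0 ≤ ρ) (hl : l ∈ Icc (0 : ℝ) 1)
    (hzz' : ‖z' - z‖ ≤ l * ρ) :
    (1 - l) ^ d * volume.real (admissible Ω t z) ≤
      volume.real (admissible Ω t z ∩ admissible Ω t z') := by
  have hscale : volume.real ((1 - l) • admissible Ω t z) =
      (1 - l) ^ d * volume.real (admissible Ω t z) := by
    have hpow : 0 ≤ (1 - l) ^ d := pow_nonneg (sub_nonneg.2 hl.2) d
    rw [measureReal_def, Measure.addHaar_smul, finrank_euclideanSpace_fin, ENNReal.toReal_mul,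
      abs_of_nonneg hpow, ENNReal.toReal_ofReal hpow, measureReal_def]
  rw [← hscale]
  refine measureReal_mono ?_
    ((measure_mono inter_subset_left).trans_lt (isCompact_admissible hΩ t z).measure_lt_top).ne
  rintro _ ⟨δ, hδ, rfl⟩
  exact ⟨smul_mem_admissible hc hz hρ hl (by simpa using mul_nonneg hl.1 hρ) hδ,
    smul_mem_admissible hc hz hρ hl hzz' hδ⟩

lemma volume_admissible_sdiff_le (hΩ : IsCompact Ω) (hc : Convex ℝ Ω)
    (hz : Metric.closedBall z ρ ⊆ Ω) (hρ : 0 ≤ ρ) (hl : l ∈ Icc (0 : ℝ) 1)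
    (hzz' : ‖z' - z‖ ≤ l * ρ) :
    volume.real (admissible Ω t z \ admissible Ω t z') ≤
      d * l * volume.real (admissible Ω t z) := by
  have hinter := pow_mul_volume_admissible_le (t := t) hΩ hc hz hρ hl hzz'
  have hsplit := measureReal_inter_add_sdiff (μ := volume) (s := admissible Ω t z)
    (isCompact_admissible hΩ t z').measurableSet (isCompact_admissible hΩ t z).measure_lt_top.ne
  have hbernoulli : 1 - d * l ≤ (1 - l) ^ d := by
    simpa only [mul_neg, ← sub_eq_add_neg] using
      one_add_mul_le_pow (a := -l) (by linarith [hl.2]) d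
  have := mul_le_mul_of_nonneg_right hbernoulli
    (measureReal_nonneg (μ := volume) (s := admissible Ω t z))
  linarith

lemma volume_admissible_le_two_pow_mul (hΩ : IsCompact Ω) (hc : Convex ℝ Ω)
    (hz : Metric.closedBall z ρ ⊆ Ω) (hρ : 0 ≤ ρ) (hzz' : ‖z' - z‖ ≤ ρ / 2) :
    volume.real (admissible Ω t z) ≤ 2 ^ d * volume.real (admissible Ω t z') := by
  have hinter := pow_mul_volume_admissible_le (t := t) (z' := z') (l := 1 / 2) hΩ hc hz hρ
    (by norm_num) (by linarith)
  have hle : volume.real (admissible Ω t z ∩ admissible Ω t z') ≤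
      volume.real (admissible Ω t z') :=
    measureReal_mono inter_subset_right (isCompact_admissible hΩ t z').measure_lt_top.ne
  have hhalf : (1 - 1 / 2 : ℝ) = 2⁻¹ := by norm_num
  rw [hhalf, inv_pow] at hinter
  exact (inv_mul_le_iff₀ (by positivity)).1 (hinter.trans hle)

open scoped symmDiff in
lemma volume_admissible_symmDiff_le (hΩ : IsCompact Ω) (hc : Convex ℝ Ω)
    (hz : Metric.closedBall z ρ ⊆ Ω) (hz' : Metric.closedBall z' ρ ⊆ Ω) (hρ : 0 ≤ ρ)
    (hl : l ∈ Icc (0 : ℝ) (1 / 2)) (hzz' : ‖z' - z‖ ≤ l * ρ) :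
    volume.real (admissible Ω t z ∆ admissible Ω t z') ≤
      d * l * (2 ^ d + 1) * volume.real (admissible Ω t z') := by
  have hl1 : l ∈ Icc (0 : ℝ) 1 := ⟨hl.1, hl.2.trans (by norm_num)⟩
  have hS := isCompact_admissible hΩ t z
  have hS' := isCompact_admissible hΩ t z'
  have hsdiff := volume_admissible_sdiff_le (t := t) hΩ hc hz hρ hl1 hzz'
  have hsdiff' := volume_admissible_sdiff_le (t := t) hΩ hc hz' hρ hl1
    (by rwa [norm_sub_rev])
  have hcomp := mul_le_mul_of_nonneg_left
    (volume_admissible_le_two_pow_mul (t := t) hΩ hc hz hρ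
      (hzz'.trans (by nlinarith [hl.2])))
    (mul_nonneg d.cast_nonneg hl.1)
  rw [measureReal_symmDiff_eq (μ := volume) hS.measurableSet hS'.measurableSet
    hS.measure_lt_top.ne hS'.measure_lt_top.ne]
  linarith

end AdmissibleVolume

section Oscillation

variable {d : ℕ} {Ω : Set (Pt d)} {lo hi : ℝ} {p₀ p₁ : Pt d → ℝ} {t ρ : ℝ} {z z' : Pt d}

open scoped symmDiff

lemma IsBoundedPair.hi_div_lo_nonneg (h : IsBoundedPair Ω lo hi p₀ p₁) (hne : Ω.Nonempty) :
    0 ≤ hi / lo :=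
  (ratioModulus_nonneg _ _ _ _).trans (h.ratioModulus_le_div hne 0)

lemma IsBoundedPair.abs_weight_sub_le (h : IsBoundedPair Ω lo hi p₀ p₁) (t : ℝ)
    (z z' δ : Pt d) :
    |weight Ω p₀ p₁ t z' δ - weight Ω p₀ p₁ t z δ| ≤
      ((1 + ratioModulus Ω p₀ p₁ ‖z' - z‖) * (1 + ratioModulus Ω p₀ p₁ ‖z' - z‖) - 1) *
          weight Ω p₀ p₁ t z' δ +
        (admissible Ω t z ∆ admissible Ω t z').indicator (fun _ => hi ^ 2) δ := by
  set ω := ratioModulus Ω p₀ p₁ ‖z' - z‖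
  have hω : 0 ≤ ω := ratioModulus_nonneg _ _ _ _
  have hw' := h.weight_nonneg t z' δ
  by_cases hδ : δ ∈ admissible Ω t z <;> by_cases hδ' : δ ∈ admissible Ω t z'
  · rw [indicator_of_notMem (by simp [mem_symmDiff, hδ, hδ']), weight_of_mem hδ,
      weight_of_mem hδ', add_zero]
    refine abs_mul_sub_mul_le (h.lo_pos.trans_le (h.mem_Icc₀ _ hδ'.1).1)
      (h.lo_pos.trans_le (h.mem_Icc₁ _ hδ'.2).1)
      (h.abs_div_sub_one_le₀ hδ.1 hδ'.1 ?_) (h.abs_div_sub_one_le₁ hδ.2 hδ'.2 ?_)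
    · rw [sub_sub_sub_cancel_right, norm_sub_rev]
    · rw [add_sub_add_right_eq_sub, norm_sub_rev]
  · rw [indicator_of_mem (by simp [mem_symmDiff, hδ, hδ']), weight_of_notMem hδ', zero_sub,
      abs_neg, abs_of_nonneg (h.weight_nonneg t z δ), mul_zero, zero_add]
    exact (h.weight_mem_Icc hδ).2
  · rw [indicator_of_mem (by simp [mem_symmDiff, hδ, hδ']), weight_of_notMem hδ, sub_zero,
      abs_of_nonneg hw']
    exact (h.weight_mem_Icc hδ').2.trans
      (le_add_of_nonneg_left (mul_nonneg (by nlinarith) hw'))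
  · rw [indicator_of_notMem (by simp [mem_symmDiff, hδ, hδ']), weight_of_notMem hδ,
      weight_of_notMem hδ']
    simp

lemma IsWeightPair.integral_abs_weight_sub_le_add (h : IsWeightPair Ω lo hi p₀ p₁)
    (hΩ : IsCompact Ω) (t : ℝ) (z z' : Pt d) :
    ∫ δ, |weight Ω p₀ p₁ t z' δ - weight Ω p₀ p₁ t z δ| ≤
      ((1 + ratioModulus Ω p₀ p₁ ‖z' - z‖) * (1 + ratioModulus Ω p₀ p₁ ‖z' - z‖) - 1) *
          (∫ δ, weight Ω p₀ p₁ t z' δ) +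
        hi ^ 2 * volume.real (admissible Ω t z ∆ admissible Ω t z') := by
  have hS := isCompact_admissible hΩ t z
  have hS' := isCompact_admissible hΩ t z'
  have hmeas : MeasurableSet (admissible Ω t z ∆ admissible Ω t z') :=
    hS.measurableSet.symmDiff hS'.measurableSet
  have hfin : volume (admissible Ω t z ∆ admissible Ω t z') ≠ ⊤ :=
    ((measure_mono symmDiff_le_sup).trans_lt
      (measure_union_lt_top hS.measure_lt_top hS'.measure_lt_top)).ne
  have hw := h.integrable_weight hΩ t z
  have hw' := h.integrable_weight hΩ t z'
  have hind : Integrable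
      ((admissible Ω t z ∆ admissible Ω t z').indicator fun _ => hi ^ 2) :=
    (integrable_indicator_iff hmeas).2 (integrableOn_const hfin)
  refine (integral_mono (hw'.sub hw).abs ((hw'.const_mul _).add hind)
    (h.abs_weight_sub_le t z z')).trans_eq ?_
  rw [integral_add' (hw'.const_mul _) hind, integral_const_mul, integral_indicator hmeas,
    setIntegral_const, smul_eq_mul, mul_comm (volume.real _)]

/-- The factor by which the relative oscillation of the weight at scale `r` and at distance `ρ`
from the boundary exceeds `ω r + r / ρ`. -/
noncomputable def velocityConst (d : ℕ) (lo hi : ℝ) : ℝ :=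
  4 + hi / lo + 2 * d * (2 ^ d + 1) * (hi / lo) ^ 2

lemma four_le_velocityConst (d : ℕ) (h : 0 ≤ hi / lo) : 4 ≤ velocityConst d lo hi := by
  have : 0 ≤ 2 * (d : ℝ) * (2 ^ d + 1) * (hi / lo) ^ 2 := by positivity
  rw [velocityConst]
  linarith

/-- The modulus of continuity, in units of `s + ω s`, of the velocity at a point at distance `ρ`
from the boundary of a domain of diameter `D`. -/
noncomputable def oscConst (d : ℕ) (D lo hi ρ : ℝ) : ℝ :=
  2 * D * velocityConst d lo hi * (1 + ρ⁻¹)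

lemma oscConst_nonneg {D : ℝ} (hD : 0 ≤ D) (h : 0 ≤ hi / lo) (hρ : 0 ≤ ρ) :
    0 ≤ oscConst d D lo hi ρ := by
  have := four_le_velocityConst d h
  rw [oscConst]
  positivity

namespace IsWeightPair

lemma sq_mul_volume_symmDiff_le (h : IsWeightPair Ω lo hi p₀ p₁) (hΩ : IsCompact Ω)
    (hc : Convex ℝ Ω) (hρ : 0 < ρ) (hz : Metric.closedBall z ρ ⊆ Ω) (hzz' : ‖z' - z‖ ≤ ρ / 4) :
    hi ^ 2 * volume.real (admissible Ω t z ∆ admissible Ω t z') ≤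
      2 * d * (2 ^ d + 1) * (hi / lo) ^ 2 * (‖z' - z‖ / ρ) * ∫ δ, weight Ω p₀ p₁ t z' δ := by
  set X := ‖z' - z‖ / ρ with hX
  have : 0 ≤ X := by positivity
  have hX1 : X ≤ 1 / 4 := by rw [hX, div_le_iff₀ hρ]; linarith
  have hball : Metric.closedBall z (ρ / 2) ⊆ Ω :=
    (Metric.closedBall_subset_closedBall (by linarith)).trans hz
  have hball' : Metric.closedBall z' (ρ / 2) ⊆ Ω :=
    (Metric.closedBall_subset_closedBall' (by rw [dist_eq_norm]; linarith)).trans hz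
  have hvol := volume_admissible_symmDiff_le (t := t) (l := 2 * X) hΩ hc hball hball' (by linarith)
    ⟨by positivity, by linarith⟩ (le_of_eq (by rw [hX]; field_simp))
  have hlo := h.lo_pos
  calc hi ^ 2 * volume.real (admissible Ω t z ∆ admissible Ω t z')
      ≤ hi ^ 2 * (d * (2 * X) * (2 ^ d + 1) * volume.real (admissible Ω t z')) := by gcongr
    _ = 2 * d * (2 ^ d + 1) * (hi / lo) ^ 2 * X *
          (lo ^ 2 * volume.real (admissible Ω t z')) := by field_simp
    _ ≤ 2 * d * (2 ^ d + 1) * (hi / lo) ^ 2 * X * ∫ δ, weight Ω p₀ p₁ t z' δ := by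
        gcongr
        exact h.mul_volume_le_integral_weight hΩ t z'

lemma integral_abs_weight_sub_le (h : IsWeightPair Ω lo hi p₀ p₁) (hΩ : IsCompact Ω)
    (hc : Convex ℝ Ω) (hρ : 0 < ρ) (hz : Metric.closedBall z ρ ⊆ Ω) (hzz' : ‖z' - z‖ ≤ ρ / 4) :
    ∫ δ, |weight Ω p₀ p₁ t z' δ - weight Ω p₀ p₁ t z δ| ≤
      velocityConst d lo hi * (ratioModulus Ω p₀ p₁ ‖z' - z‖ + ‖z' - z‖ / ρ) *
        ∫ δ, weight Ω p₀ p₁ t z' δ := by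
  have hsymm := h.sq_mul_volume_symmDiff_le (t := t) hΩ hc hρ hz hzz'
  refine (h.integral_abs_weight_sub_le_add hΩ t z z').trans ?_
  have hN : 0 ≤ ∫ δ, weight Ω p₀ p₁ t z' δ := integral_nonneg (h.weight_nonneg t z')
  have hω : 0 ≤ ratioModulus Ω p₀ p₁ ‖z' - z‖ := ratioModulus_nonneg _ _ _ _
  have hωM : ratioModulus Ω p₀ p₁ ‖z' - z‖ ≤ hi / lo :=
    h.ratioModulus_le_div ⟨z, hz (Metric.mem_closedBall_self hρ.le)⟩ _
  have hX : 0 ≤ ‖z' - z‖ / ρ := by positivity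
  generalize ratioModulus Ω p₀ p₁ ‖z' - z‖ = ω, ‖z' - z‖ / ρ = X,
    ∫ δ, weight Ω p₀ p₁ t z' δ = N at *
  have hM : 0 ≤ hi / lo := hω.trans hωM
  calc ((1 + ω) * (1 + ω) - 1) * N +
        hi ^ 2 * volume.real (admissible Ω t z ∆ admissible Ω t z')
      ≤ (2 + hi / lo) * ω * N + 2 * d * (2 ^ d + 1) * (hi / lo) ^ 2 * X * N :=
        add_le_add (mul_le_mul_of_nonneg_right (by nlinarith) hN) hsymm
    _ ≤ velocityConst d lo hi * (ω + X) * N := by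
        have hrest : 0 ≤ (2 + 2 * d * (2 ^ d + 1) * (hi / lo) ^ 2) * ω * N +
          (4 + hi / lo) * X * N := by positivity
        rw [velocityConst]
        linarith

lemma norm_velocity_sub_le (h : IsWeightPair Ω lo hi p₀ p₁) (hΩ : IsCompact Ω)
    (hc : Convex ℝ Ω) (ht : t ∈ Icc (0 : ℝ) 1) (hρ : 0 < ρ) (hz : Metric.closedBall z ρ ⊆ Ω)
    (z' : Pt d) :
    ‖velocity Ω p₀ p₁ t z' - velocity Ω p₀ p₁ t z‖ ≤
      2 * Metric.diam Ω * (velocityConst d lo hi *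
        (ratioModulus Ω p₀ p₁ ‖z' - z‖ + ‖z' - z‖ / ρ)) := by
  rcases le_or_gt ‖z' - z‖ (ρ / 4) with hnear | hfar
  · have hball : ∀ w ∈ Metric.ball z ρ, w ∈ interior Ω := fun w hw =>
      interior_mono hz (Metric.ball_subset_interior_closedBall hw)
    exact norm_velocity_sub_velocity_le_of_integral_le h h hΩ ht
      (hball z (Metric.mem_ball_self hρ))
      (hball z' (mem_ball_iff_norm.2 (by linarith)))
      (h.integral_abs_weight_sub_le hΩ hc hρ hz hnear)
  · have hV := four_le_velocityConst d
      (h.hi_div_lo_nonneg ⟨z, hz (Metric.mem_closedBall_self hρ.le)⟩)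
    have hX : 1 / 4 ≤ ratioModulus Ω p₀ p₁ ‖z' - z‖ + ‖z' - z‖ / ρ := by
      have hquarter : 1 / 4 ≤ ‖z' - z‖ / ρ := by rw [le_div_iff₀ hρ]; linarith
      exact hquarter.trans (le_add_of_nonneg_left (ratioModulus_nonneg _ _ _ _))
    calc _ ≤ Metric.diam Ω + Metric.diam Ω :=
          (norm_sub_le _ _).trans
            (add_le_add (h.norm_velocity_le hΩ t z') (h.norm_velocity_le hΩ t z))
      _ = 2 * Metric.diam Ω * 1 := by ring
      _ ≤ _ := mul_le_mul_of_nonneg_left (by nlinarith)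
          (mul_nonneg zero_le_two Metric.diam_nonneg)

lemma norm_velocity_sub_le_oscConst (h : IsWeightPair Ω lo hi p₀ p₁) (hΩ : IsCompact Ω)
    (hc : Convex ℝ Ω) (ht : t ∈ Icc (0 : ℝ) 1) (hρ : 0 < ρ) (hz : Metric.closedBall z ρ ⊆ Ω)
    (z' : Pt d) :
    ‖velocity Ω p₀ p₁ t z' - velocity Ω p₀ p₁ t z‖ ≤
      oscConst d (Metric.diam Ω) lo hi ρ *
        (‖z' - z‖ + ratioModulus Ω p₀ p₁ ‖z' - z‖) := by
  refine (h.norm_velocity_sub_le hΩ hc ht hρ hz z').trans ?_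
  have hV := four_le_velocityConst d
    (h.hi_div_lo_nonneg ⟨z, hz (Metric.mem_closedBall_self hρ.le)⟩)
  have hω := ratioModulus_nonneg Ω p₀ p₁ ‖z' - z‖
  have hscale : ratioModulus Ω p₀ p₁ ‖z' - z‖ + ‖z' - z‖ / ρ ≤
      (1 + ρ⁻¹) * (‖z' - z‖ + ratioModulus Ω p₀ p₁ ‖z' - z‖) := by
    have hrest : 0 ≤ ‖z' - z‖ + ρ⁻¹ * ratioModulus Ω p₀ p₁ ‖z' - z‖ := by positivity
    rw [div_eq_mul_inv]
    linarith
  rw [oscConst, mul_assoc _ (1 + ρ⁻¹), mul_assoc (2 * Metric.diam Ω)]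
  have : 0 ≤ Metric.diam Ω := Metric.diam_nonneg
  gcongr

end IsWeightPair

end Oscillation

section Osgood

variable {ω : ℝ → ℝ}

lemma psi_of_pos {u : ℝ} (hu : 0 < u) : psi ω u = psiReal ω u := if_pos hu

lemma psi_of_nonpos {u : ℝ} (hu : u ≤ 0) : psi ω u = ⊥ := if_neg hu.not_gt

lemma psiInv_nonneg (ω : ℝ → ℝ) (y : EReal) : 0 ≤ psiInv ω y :=
  Real.sSup_nonneg fun _ h => h.1

lemma psiInv_bot (ω : ℝ → ℝ) : psiInv ω ⊥ = 0 := by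
  refine le_antisymm (Real.sSup_le (fun u hu => ?_) le_rfl) (psiInv_nonneg ω ⊥)
  by_contra! hpos
  exact EReal.coe_ne_bot _ ((psi_of_pos hpos).symm.trans (le_bot_iff.1 hu.2))

lemma psiInv_psi_zero_add (ω : ℝ → ℝ) (b : ℝ) : psiInv ω (psi ω 0 + b) = 0 := by
  rw [psi_of_nonpos le_rfl, EReal.bot_add, psiInv_bot]

lemma psi_add_coe_ne_top (a b : ℝ) : psi ω a + b ≠ ⊤ := by
  rcases le_or_gt a 0 with ha | ha
  · simp [psi_of_nonpos ha]
  · rw [psi_of_pos ha, ← EReal.coe_add]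
    exact EReal.coe_ne_top _

namespace IsOsgoodModulus

lemma continuousOn_Ici (h : IsOsgoodModulus ω) : ContinuousOn ω (Ici 0) := by
  intro a (ha : 0 ≤ a)
  rcases ha.eq_or_lt with rfl | ha
  · have hlim := h.osgood.tendsto_zero h.mono h.nonneg
    have hzero : ω 0 = 0 := le_antisymm
      (ge_of_tendsto hlim (eventually_mem_nhdsWithin.mono fun u hu => h.mono (mem_Ioi.1 hu).le))
      (h.nonneg 0)
    rw [← continuousWithinAt_Ioi_iff_Ici, ContinuousWithinAt, hzero]
    exact hlim
  · exact (h.continuousOn.continuousAt (Ioi_mem_nhds ha)).continuousWithinAt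

lemma add_self_pos (h : IsOsgoodModulus ω) {s : ℝ} (hs : 0 < s) : 0 < s + ω s :=
  add_pos_of_pos_of_nonneg hs (h.nonneg s)

lemma continuousOn_one_div (h : IsOsgoodModulus ω) :
    ContinuousOn (fun s => 1 / (s + ω s)) (Ioi 0) :=
  continuousOn_const.div (continuousOn_id.add h.continuousOn) fun _ hs => (h.add_self_pos hs).ne'

lemma intervalIntegrable_one_div (h : IsOsgoodModulus ω) {a b : ℝ} (ha : 0 < a) (hb : 0 < b) :
    IntervalIntegrable (fun s => 1 / (s + ω s)) volume a b :=
  (h.continuousOn_one_div.mono fun _ hs => (lt_min ha hb).trans_le hs.1).intervalIntegrable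

lemma psiReal_sub (h : IsOsgoodModulus ω) {a b : ℝ} (ha : 0 < a) (hb : 0 < b) :
    psiReal ω b - psiReal ω a = ∫ s in a..b, 1 / (s + ω s) :=
  intervalIntegral.integral_interval_sub_left (h.intervalIntegrable_one_div one_pos hb)
    (h.intervalIntegrable_one_div one_pos ha)

lemma hasDerivAt_psiReal (h : IsOsgoodModulus ω) {a : ℝ} (ha : 0 < a) :
    HasDerivAt (psiReal ω) (1 / (a + ω a)) a :=
  intervalIntegral.integral_hasDerivAt_right (h.intervalIntegrable_one_div one_pos ha)
    (h.continuousOn_one_div.stronglyMeasurableAtFilter isOpen_Ioi a ha)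
    (h.continuousOn_one_div.continuousAt (Ioi_mem_nhds ha))

lemma strictMonoOn_psiReal (h : IsOsgoodModulus ω) : StrictMonoOn (psiReal ω) (Ioi 0) := by
  intro a (ha : 0 < a) b (hb : 0 < b) hab
  rw [← sub_pos, h.psiReal_sub ha hb]
  exact intervalIntegral.intervalIntegral_pos_of_pos_on (h.intervalIntegrable_one_div ha hb)
    (fun s hs => one_div_pos.2 (h.add_self_pos (ha.trans hs.1))) hab

lemma log_div_le (h : IsOsgoodModulus ω) {L a b : ℝ} (ha : 0 < a) (hab : a ≤ b)
    (hL : ∀ u ∈ Icc a b, ω u ≤ L * u) :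
    Real.log (b / a) ≤ (L + 1) * (psiReal ω b - psiReal ω a) := by
  have hb : 0 < b := ha.trans_le hab
  have hpos : ∀ s ∈ uIcc a b, s ≠ 0 := fun s hs => by
    rw [uIcc_of_le hab] at hs
    exact (ha.trans_le hs.1).ne'
  rw [h.psiReal_sub ha hb, ← integral_one_div_of_pos ha hb, ← intervalIntegral.integral_const_mul]
  refine intervalIntegral.integral_mono_on hab
    (intervalIntegral.intervalIntegrable_one_div hpos continuousOn_id)
    ((h.intervalIntegrable_one_div ha hb).const_mul _) fun s hs => ?_
  have hs0 : 0 < s := ha.trans_le hs.1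
  rw [mul_one_div, div_le_div_iff₀ hs0 (h.add_self_pos hs0)]
  linarith [hL s hs]

lemma tendsto_psiReal_atTop (h : IsOsgoodModulus ω) : Tendsto (psiReal ω) atTop atTop := by
  obtain ⟨M, hM⟩ := h.bounded
  have hM0 : 0 ≤ M := (h.nonneg 0).trans (hM 0)
  have hpsi1 : psiReal ω 1 = 0 := intervalIntegral.integral_same
  refine tendsto_atTop_mono' _ ?_ (Real.tendsto_log_atTop.const_mul_atTop (by positivity :
    0 < (M + 1)⁻¹))
  filter_upwards [eventually_ge_atTop 1] with u hu
  have hlog := h.log_div_le (L := M) one_pos hu fun s hs =>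
    (hM s).trans (le_mul_of_one_le_right hM0 hs.1)
  rw [div_one, hpsi1, sub_zero] at hlog
  exact (inv_mul_le_iff₀ (by positivity)).2 hlog

lemma monotone_psi (h : IsOsgoodModulus ω) : Monotone (psi ω) := by
  intro a b hab
  rcases le_or_gt a 0 with ha | ha
  · simp [psi_of_nonpos ha]
  · rw [psi_of_pos ha, psi_of_pos (ha.trans_le hab), EReal.coe_le_coe_iff]
    exact h.strictMonoOn_psiReal.monotoneOn ha (ha.trans_le hab) hab

lemma bddAbove_psi_le (h : IsOsgoodModulus ω) {y : EReal} (hy : y ≠ ⊤) :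
    BddAbove {u | 0 ≤ u ∧ psi ω u ≤ y} := by
  obtain ⟨N, hN, hN0⟩ := ((h.tendsto_psiReal_atTop.eventually
    (eventually_gt_atTop y.toReal)).and (eventually_gt_atTop 0)).exists
  refine ⟨N, fun u hu => ?_⟩
  by_contra! hNu
  have hle : psi ω N ≤ y := (h.monotone_psi hNu.le).trans hu.2
  rw [psi_of_pos hN0] at hle
  exact (EReal.coe_le_coe_iff.1 (hle.trans (EReal.le_coe_toReal hy))).not_gt hN

lemma psiInv_mono (h : IsOsgoodModulus ω) {y y' : EReal} (hyy' : y ≤ y') (hy' : y' ≠ ⊤) :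
    psiInv ω y ≤ psiInv ω y' :=
  Real.sSup_le (fun _ hu => le_csSup (h.bddAbove_psi_le hy') ⟨hu.1, hu.2.trans hyy'⟩)
    (psiInv_nonneg ω y')

lemma psiInv_psi_add_mono (h : IsOsgoodModulus ω) {a a' b b' : ℝ} (ha : a ≤ a') (hb : b ≤ b') :
    psiInv ω (psi ω a + b) ≤ psiInv ω (psi ω a' + b') :=
  h.psiInv_mono (add_le_add (h.monotone_psi ha) (EReal.coe_le_coe_iff.2 hb))
    (psi_add_coe_ne_top a' b')

lemma le_psiInv_psi_add (h : IsOsgoodModulus ω) {a b u : ℝ} (ha : 0 < a)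
    (hle : 0 < u → psiReal ω u ≤ psiReal ω a + b) : u ≤ psiInv ω (psi ω a + b) := by
  rcases le_or_gt u 0 with hu | hu
  · exact hu.trans (psiInv_nonneg _ _)
  · refine le_csSup (h.bddAbove_psi_le (psi_add_coe_ne_top a b)) ⟨hu.le, ?_⟩
    rw [psi_of_pos ha, psi_of_pos hu]
    exact_mod_cast hle hu

lemma psiInv_psi_add_le (h : IsOsgoodModulus ω) {a b θ : ℝ} (ha : 0 < a) (hθ : 0 < θ)
    (hle : psiReal ω a + b ≤ psiReal ω θ) : psiInv ω (psi ω a + b) ≤ θ := by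
  refine Real.sSup_le (fun u hu => ?_) hθ.le
  by_contra! hθu
  have hu0 : 0 < u := hθ.trans hθu
  have hu := hu.2
  rw [psi_of_pos ha, psi_of_pos hu0, ← EReal.coe_add, EReal.coe_le_coe_iff] at hu
  exact (hu.trans hle).not_gt (h.strictMonoOn_psiReal hθ hu0 hθu)

lemma exists_psiInv_psi_add_le (h : IsOsgoodModulus ω) (b : ℝ) {θ : ℝ} (hθ : 0 < θ) :
    ∃ a > 0, psiInv ω (psi ω a + b) ≤ θ := by
  obtain ⟨a, ha, ha0⟩ := ((h.osgood.eventually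
    (eventually_le_atBot (psiReal ω θ - b))).and self_mem_nhdsWithin).exists
  exact ⟨a, ha0, h.psiInv_psi_add_le ha0 hθ (by linarith)⟩

lemma psiInv_psi_add_le_mul_exp (h : IsOsgoodModulus ω) {L a b : ℝ}
    (hL : ∀ u, 0 ≤ u → ω u ≤ L * u) (ha : 0 ≤ a) (hb : 0 ≤ b) :
    psiInv ω (psi ω a + b) ≤ a * Real.exp ((L + 1) * b) := by
  rcases ha.eq_or_lt with rfl | ha
  · rw [psiInv_psi_zero_add, zero_mul]
  have hL0 : 0 < L + 1 := by linarith [hL 1 zero_le_one, h.nonneg 1]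
  have hlog := h.log_div_le ha
    (le_mul_of_one_le_right ha.le (Real.one_le_exp (mul_nonneg hL0.le hb)))
    fun u hu => hL u (ha.le.trans hu.1)
  rw [mul_div_cancel_left₀ _ ha.ne', Real.log_exp] at hlog
  have := le_of_mul_le_mul_left hlog hL0
  exact h.psiInv_psi_add_le ha (by positivity) (by linarith)

variable {K T t : ℝ}

lemma psiReal_le_of_hasDerivAt_le (h : IsOsgoodModulus ω) {G G' : ℝ → ℝ}
    (hG : ContinuousOn G (Icc 0 T)) (hpos : ∀ s ∈ Icc 0 T, 0 < G s)
    (hderiv : ∀ s ∈ Ioo 0 T, HasDerivAt G (G' s) s)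
    (hle : ∀ s ∈ Ioo 0 T, G' s ≤ K * (G s + ω (G s))) (ht : t ∈ Icc 0 T) :
    psiReal ω (G t) ≤ psiReal ω (G 0) + K * t := by
  have hd : ∀ s ∈ Ioo 0 T,
      HasDerivAt (fun s => psiReal ω (G s)) (1 / (G s + ω (G s)) * G' s) s := fun s hs =>
    (h.hasDerivAt_psiReal (hpos s (Ioo_subset_Icc_self hs))).comp s (hderiv s hs)
  have hcont : ContinuousOn (fun s => psiReal ω (G s)) (Icc 0 T) := fun s hs =>
    (h.hasDerivAt_psiReal (hpos s hs)).continuousAt.comp_continuousWithinAt (hG s hs)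
  have hmvt := (convex_Icc 0 T).image_sub_le_mul_sub_of_deriv_le hcont
    (fun s hs => (hd s (interior_Icc (α := ℝ) ▸ hs)).differentiableAt.differentiableWithinAt)
    (C := K) (fun s hs => ?_) 0 ⟨le_rfl, ht.1.trans ht.2⟩ t ht ht.1
  · linarith
  · rw [interior_Icc] at hs
    rw [(hd s hs).deriv, one_div,
      inv_mul_le_iff₀ (h.add_self_pos (hpos s (Ioo_subset_Icc_self hs))),
      mul_comm]
    exact hle s hs

variable {u : ℝ → ℝ}

lemma continuousOn_add_comp (h : IsOsgoodModulus ω) (hu : ContinuousOn u (Icc 0 T))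
    (hu0 : ∀ s ∈ Icc 0 T, 0 ≤ u s) : ContinuousOn (fun s => u s + ω (u s)) (Icc 0 T) :=
  hu.add (h.continuousOn_Ici.comp hu hu0)

lemma psiReal_le_of_le_integral (h : IsOsgoodModulus ω) {a : ℝ} (ha : 0 < a) (hK : 0 ≤ K)
    (hu : ContinuousOn u (Icc 0 T)) (hu0 : ∀ s ∈ Icc 0 T, 0 ≤ u s)
    (hle : ∀ s ∈ Icc 0 T, u s ≤ a + ∫ r in (0 : ℝ)..s, K * (u r + ω (u r)))
    (ht : t ∈ Icc 0 T) (hpos : 0 < u t) : psiReal ω (u t) ≤ psiReal ω a + K * t := by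
  set φ : ℝ → ℝ := fun s => K * (u s + ω (u s))
  set G : ℝ → ℝ := fun s => a + ∫ r in (0 : ℝ)..s, φ r with hG
  have hT : (0 : ℝ) ≤ T := ht.1.trans ht.2
  have hφc : ContinuousOn φ (Icc 0 T) := continuousOn_const.mul (h.continuousOn_add_comp hu hu0)
  have hφint : ∀ s ∈ Icc 0 T, IntervalIntegrable φ volume 0 s := fun s hs =>
    (hφc.mono (Icc_subset_Icc_right hs.2)).intervalIntegrable_of_Icc hs.1
  have hφ0 : ∀ s ∈ Icc 0 T, 0 ≤ φ s := fun s hs =>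
    mul_nonneg hK (add_nonneg (hu0 s hs) (h.nonneg _))
  have hGpos : ∀ s ∈ Icc 0 T, 0 < G s := fun s hs => add_pos_of_pos_of_nonneg ha
    (intervalIntegral.integral_nonneg hs.1 fun r hr => hφ0 r ⟨hr.1, hr.2.trans hs.2⟩)
  have hGc : ContinuousOn G (Icc 0 T) := by
    have := intervalIntegral.continuousOn_primitive_interval' (hφint T ⟨hT, le_rfl⟩)
      left_mem_uIcc
    rw [uIcc_of_le hT] at this
    exact continuousOn_const.add this
  have hGderiv : ∀ s ∈ Ioo 0 T, HasDerivAt G (φ s) s := fun s hs =>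
    (intervalIntegral.integral_hasDerivAt_right (hφint s (Ioo_subset_Icc_self hs))
      ((hφc.mono Ioo_subset_Icc_self).stronglyMeasurableAtFilter isOpen_Ioo s hs)
      (hφc.continuousAt (Icc_mem_nhds hs.1 hs.2))).const_add a
  have hosgood := h.psiReal_le_of_hasDerivAt_le (K := K) hGc hGpos hGderiv
    (fun s hs => mul_le_mul_of_nonneg_left
      (add_le_add (hle s (Ioo_subset_Icc_self hs)) (h.mono (hle s (Ioo_subset_Icc_self hs)))) hK) ht
  have hG0 : G 0 = a := by simp [hG]
  rw [hG0] at hosgood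
  exact (h.strictMonoOn_psiReal.monotoneOn hpos (hGpos t ht) (hle t ht)).trans hosgood

lemma le_psiInv_of_le_integral (h : IsOsgoodModulus ω) {a : ℝ} (ha : 0 ≤ a) (hK : 0 ≤ K)
    (hu : ContinuousOn u (Icc 0 T)) (hu0 : ∀ s ∈ Icc 0 T, 0 ≤ u s)
    (hle : ∀ s ∈ Icc 0 T, u s ≤ a + ∫ r in (0 : ℝ)..s, K * (u r + ω (u r)))
    (ht : t ∈ Icc 0 T) : u t ≤ psiInv ω (psi ω a + (K * t : ℝ)) := by
  have hpos : ∀ a' > 0, a ≤ a' → u t ≤ psiInv ω (psi ω a' + (K * t : ℝ)) := fun a' ha' haa' =>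
    h.le_psiInv_psi_add ha' fun hut => h.psiReal_le_of_le_integral ha' hK hu hu0
      (fun s hs => (hle s hs).trans (by gcongr)) ht hut
  rcases ha.eq_or_lt with rfl | ha
  · refine (le_of_forall_pos_le_add fun θ hθ => ?_).trans (psiInv_nonneg _ _)
    obtain ⟨a', ha', hsmall⟩ := h.exists_psiInv_psi_add_le (K * t) hθ
    simpa using (hpos a' ha' ha'.le).trans hsmall
  · exact hpos a ha le_rfl

end IsOsgoodModulus

end Osgood

section InwardField

variable {d : ℕ}

/-- The properties of a velocity field on a convex set `Ω` from which the existence, uniqueness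
and stability of its flow follow: from every interior point, displacing by `-t • v t z` and by
`(1 - t) • v t z` stays in `Ω`, and at distance `ρ` from the boundary `v t` oscillates by at most
`K ρ * (u + ω u)` over a distance `u`. -/
structure IsInwardField (Ω : Set (Pt d)) (ω K : ℝ → ℝ) (v : ℝ → Pt d → Pt d) : Prop where
  measurable : Measurable fun q : ℝ × Pt d => v q.1 q.2
  norm_le : ∀ t z, ‖v t z‖ ≤ Metric.diam Ω
  mem_admissible : ∀ t ∈ Icc (0 : ℝ) 1, ∀ z ∈ interior Ω, v t z ∈ admissible Ω t z
  nonneg : ∀ ρ > 0, 0 ≤ K ρ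
  norm_sub_le : ∀ t ∈ Icc (0 : ℝ) 1, ∀ ρ > 0, ∀ z, Metric.closedBall z ρ ⊆ Ω → ∀ z',
    ‖v t z' - v t z‖ ≤ K ρ * (‖z' - z‖ + ω ‖z' - z‖)

lemma IsWeightPair.isInwardField {Ω : Set (Pt d)} {lo hi : ℝ} {p₀ p₁ : Pt d → ℝ}
    (h : IsWeightPair Ω lo hi p₀ p₁) (hΩ : IsCompact Ω) (hc : Convex ℝ Ω) (hne : Ω.Nonempty) :
    IsInwardField Ω (ratioModulus Ω p₀ p₁) (oscConst d (Metric.diam Ω) lo hi)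
      (velocity Ω p₀ p₁) where
  measurable := h.measurable_velocity hΩ
  norm_le := h.norm_velocity_le hΩ
  mem_admissible _ ht _ hz := h.velocity_mem_admissible hΩ hc ht hz
  nonneg _ hρ := oscConst_nonneg Metric.diam_nonneg (h.hi_div_lo_nonneg hne) hρ.le
  norm_sub_le _ ht _ hρ _ hz := h.norm_velocity_sub_le_oscConst hΩ hc ht hρ hz

end InwardField

section Interval

lemma uIcc_subset_uIcc_zero {a b T : ℝ} (ha : a ∈ Icc 0 T) (hb : b ∈ Icc 0 T) :
    uIcc a b ⊆ uIcc 0 T := by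
  rw [uIcc_of_le (ha.1.trans ha.2)]
  exact uIcc_subset_Icc ha hb

lemma integral_nonpos_of_forall_integral_pos {g : ℝ → ℝ} {T : ℝ}
    (hg : IntervalIntegrable g volume 0 T)
    (hneg : ∀ s ∈ Ioo 0 T, 0 < ∫ r in (0 : ℝ)..s, g r → g s ≤ 0) {t : ℝ} (ht : t ∈ Icc 0 T) :
    ∫ s in (0 : ℝ)..t, g s ≤ 0 := by
  have hT : 0 ≤ T := ht.1.trans ht.2
  have h0 : (0 : ℝ) ∈ Icc 0 T := ⟨le_rfl, hT⟩
  set φ : ℝ → ℝ := fun s => ∫ r in (0 : ℝ)..s, g r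
  have hφ : ContinuousOn φ (Icc 0 T) := by
    simpa only [uIcc_of_le hT] using
      intervalIntegral.continuousOn_primitive_interval' hg left_mem_uIcc
  -- the last time before `t` at which the primitive is nonpositive
  set A := Icc 0 t ∩ φ ⁻¹' Iic 0
  have hA_closed : IsClosed A :=
    (hφ.mono (Icc_subset_Icc_right ht.2)).preimage_isClosed_of_isClosed isClosed_Icc isClosed_Iic
  have hA_bdd : BddAbove A := ⟨t, fun s hs => hs.1.2⟩
  have hA : sSup A ∈ A := hA_closed.csSup_mem
    ⟨0, ⟨le_rfl, ht.1⟩, (intervalIntegral.integral_same (f := g)).le⟩ hA_bdd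
  have ha : sSup A ∈ Icc 0 T := ⟨hA.1.1, hA.1.2.trans ht.2⟩
  have hpos : ∀ s ∈ Ioo (sSup A) t, 0 < φ s := fun s hs => by
    by_contra! hle
    exact hs.1.not_ge (le_csSup hA_bdd ⟨⟨ha.1.trans hs.1.le, hs.2.le⟩, hle⟩)
  have hdecr : ∫ s in (sSup A)..t, g s ≤ ∫ _ in (sSup A)..t, (0 : ℝ) :=
    intervalIntegral.integral_mono_on_of_le_Ioo hA.1.2
      (hg.mono_set (uIcc_subset_uIcc_zero ha ht)) intervalIntegrable_const
      fun s hs => hneg s ⟨ha.1.trans_lt hs.1, hs.2.trans_le ht.2⟩ (hpos s hs)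
  rw [intervalIntegral.integral_zero, ← intervalIntegral.integral_interval_sub_left
    (hg.mono_set (uIcc_subset_uIcc_zero h0 ht)) (hg.mono_set (uIcc_subset_uIcc_zero h0 ha)),
    sub_nonpos] at hdecr
  exact hdecr.trans hA.2

end Interval

section ConvexPath

variable {E : Type*} [NormedAddCommGroup E] [NormedSpace ℝ E]

lemma closedBall_combo_subset {s : Set E} (hs : Convex ℝ s) {x w : E} {ε t : ℝ}
    (hx : Metric.closedBall x ε ⊆ s) (hw : w ∈ s) (ht : t ∈ Icc (0 : ℝ) 1) :
    Metric.closedBall ((1 - t) • x + t • w) ((1 - t) * ε) ⊆ s := by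
  intro y hy
  rw [mem_closedBall_iff_norm] at hy
  rcases ht.2.eq_or_lt with rfl | h
  · rw [sub_self, zero_mul, norm_le_zero_iff, sub_eq_zero] at hy
    simpa [hy] using hw
  · have h1 : 0 < 1 - t := sub_pos.2 h
    have hy_eq : y = (1 - t) • (x + (1 - t)⁻¹ • (y - ((1 - t) • x + t • w))) + t • w := by
      rw [smul_add, smul_inv_smul₀ h1.ne']
      module
    rw [hy_eq]
    refine hs (hx ?_) hw h1.le ht.1 (sub_add_cancel 1 t)
    rwa [mem_closedBall_iff_norm, add_sub_cancel_left, norm_smul,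
      Real.norm_of_nonneg (inv_nonneg.2 h1.le), inv_mul_le_iff₀ h1]

/-- A path is inward in `s` on `[0, T]` if its velocity `V` always points to a target in `s` that
would be reached at time `1`. -/
structure IsInwardPath (s : Set E) (T : ℝ) (x : E) (V y : ℝ → E) : Prop where
  integrable : IntervalIntegrable V volume 0 T
  eq_integral : ∀ t ∈ Icc 0 T, y t = x + ∫ r in (0 : ℝ)..t, V r
  target_mem : ∀ t ∈ Ioo 0 T, y t + (1 - t) • V t ∈ s

variable [CompleteSpace E] {s : Set E} {T : ℝ} {x : E} {V y : ℝ → E}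

lemma IsInwardPath.apply_le_combo (h : IsInwardPath s T x V y) (hT : T ≤ 1) {f : StrongDual ℝ E}
    {c : ℝ} (hf : ∀ w ∈ s, f w < c) {t : ℝ} (ht : t ∈ Icc 0 T) :
    f (y t) ≤ (1 - t) * f x + t * c := by
  have h_int : ∀ r ∈ Icc 0 T, IntervalIntegrable V volume 0 r := fun r hr =>
    h.integrable.mono_set (uIcc_subset_uIcc_zero ⟨le_rfl, hr.1.trans hr.2⟩ hr)
  have hfV : ∀ r ∈ Icc 0 T, IntervalIntegrable (fun s => f (V s)) volume 0 r := fun r hr =>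
    ⟨f.integrable_comp (h_int r hr).1, f.integrable_comp (h_int r hr).2⟩
  have hφ : ∀ r ∈ Icc 0 T,
      ∫ s in (0 : ℝ)..r, (f (V s) + (f x - c)) = f (y r) - ((1 - r) * f x + r * c) := by
    intro r hr
    rw [intervalIntegral.integral_add (hfV r hr) intervalIntegrable_const,
      intervalIntegral.integral_const, f.intervalIntegral_comp_comm (h_int r hr),
      h.eq_integral r hr, map_add, smul_eq_mul]
    ring
  have hfVT := hfV T ⟨ht.1.trans ht.2, le_rfl⟩
  rw [← sub_nonpos, ← hφ t ht]
  refine integral_nonpos_of_forall_integral_pos (hfVT.add intervalIntegrable_const)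
    (fun r hr hpos => ?_) ht
  rw [hφ r (Ioo_subset_Icc_self hr)] at hpos
  have h_target := hf _ (h.target_mem r hr)
  rw [map_add, map_smul, smul_eq_mul] at h_target
  have h1r : 0 < 1 - r := by linarith [hr.2]
  have h_neg : (1 - r) * (f (V r) + (f x - c)) < 0 := by nlinarith
  exact (neg_of_mul_neg_right h_neg h1r.le).le

lemma IsInwardPath.exists_eq_combo (h : IsInwardPath s T x V y) (hs : Convex ℝ s)
    (hcl : IsClosed s) (hne : s.Nonempty) (hT : T ≤ 1) {t : ℝ} (ht : t ∈ Icc 0 T) :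
    ∃ w ∈ s, y t = (1 - t) • x + t • w := by
  rcases ht.1.eq_or_lt with rfl | ht0
  · exact hne.imp fun w hw => ⟨hw, by simp [h.eq_integral 0 ht]⟩
  refine ⟨t⁻¹ • (y t - (1 - t) • x), ?_, by rw [smul_inv_smul₀ ht0.ne']; module⟩
  by_contra hnot
  obtain ⟨f, c, hf, hfc⟩ := geometric_hahn_banach_closed_point hs hcl hnot
  rw [map_smul, map_sub, map_smul, smul_eq_mul, smul_eq_mul, lt_inv_mul_iff₀ ht0] at hfc
  linarith [h.apply_le_combo hT hf ht]

lemma IsInwardPath.closedBall_subset (h : IsInwardPath s T x V y) (hs : Convex ℝ s)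
    (hcl : IsClosed s) (hne : s.Nonempty) (hT : T ≤ 1) {ε : ℝ} (hx : Metric.closedBall x ε ⊆ s)
    {t : ℝ} (ht : t ∈ Icc 0 T) : Metric.closedBall (y t) ((1 - t) * ε) ⊆ s := by
  obtain ⟨w, hw, hy⟩ := h.exists_eq_combo hs hcl hne hT ht
  rw [hy]
  exact closedBall_combo_subset hs hx hw ⟨ht.1, ht.2.trans hT⟩

end ConvexPath

section Ball

lemma exists_closedBall_subset {E : Type*} [PseudoMetricSpace E] {s : Set E} {x : E}
    (hx : x ∈ interior s) : ∃ ε > 0, Metric.closedBall x ε ⊆ s :=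
  Metric.nhds_basis_closedBall.mem_iff.1 (mem_interior_iff_mem_nhds.1 hx)

lemma mem_interior_of_closedBall_subset {E : Type*} [PseudoMetricSpace E] {s : Set E} {x : E}
    {ε : ℝ} (hε : 0 < ε) (h : Metric.closedBall x ε ⊆ s) : x ∈ interior s :=
  interior_mono h (Metric.ball_subset_interior_closedBall (Metric.mem_ball_self hε))

variable {E : Type*} [NormedAddCommGroup E] [NormedSpace ℝ E] {s : Set E}

lemma closedBall_subset_of_lt_infDist {z : E} (hz : z ∈ s) {γ : ℝ} (hγ : 0 ≤ γ)
    (h : γ < Metric.infDist z (frontier s)) : Metric.closedBall z γ ⊆ s := by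
  have hzγ := Metric.mem_closedBall_self (x := z) hγ
  have h_union : Metric.closedBall z γ ⊆ interior s ∪ interior sᶜ := by
    rw [← compl_frontier_eq_union_interior]
    exact (Metric.disjoint_closedBall_of_lt_infDist h).subset_compl_right
  have hz_int : z ∈ interior s :=
    (h_union hzγ).resolve_right fun hz' => interior_subset hz' hz
  exact ((convex_closedBall z γ).isPreconnected.subset_left_of_subset_union isOpen_interior
    isOpen_interior ((disjoint_compl_right (a := s)).mono interior_subset interior_subset) h_union
    ⟨z, hzγ, hz_int⟩).trans interior_subset

lemma two_mul_le_diam (hs : Bornology.IsBounded s) (hfr : (frontier s).Nonempty) {x : E} {ε : ℝ}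
    (hε : 0 ≤ ε) (hx : Metric.closedBall x ε ⊆ s) : 2 * ε ≤ Metric.diam s := by
  have : Nontrivial E := by
    by_contra hE
    rw [not_nontrivial_iff_subsingleton] at hE
    obtain ⟨hne, hs'⟩ := nonempty_frontier_iff.1 hfr
    exact hs' (Subsingleton.eq_univ_of_nonempty hne)
  rw [← Metric.diam_closedBall_eq x hε]
  exact Metric.diam_mono hx hs

end Ball

section Comparison

lemma IsOsgoodModulus.norm_sub_le_psiInv {E : Type*} [NormedAddCommGroup E] [NormedSpace ℝ E]
    {ω : ℝ → ℝ} (h : IsOsgoodModulus ω) {y y' V V' : ℝ → E} {a e K T : ℝ} (ha : 0 ≤ a)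
    (he : 0 ≤ e) (hK : 0 ≤ K) (hV : IntervalIntegrable V volume 0 T)
    (hV' : IntervalIntegrable V' volume 0 T)
    (hdefect : ∀ t ∈ Icc 0 T, ‖y' t - y t - ∫ s in (0 : ℝ)..t, (V' s - V s)‖ ≤ a)
    (hle : ∀ s ∈ Ioo 0 T, ‖V' s - V s‖ ≤ e + K * (‖y' s - y s‖ + ω ‖y' s - y s‖))
    {t : ℝ} (ht : t ∈ Icc 0 T) :
    ‖y' t - y t‖ ≤ psiInv ω (psi ω (a + e * T) + (K * t : ℝ)) := by
  have hT : 0 ≤ T := ht.1.trans ht.2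
  have hVV := hV'.sub hV
  -- a continuous majorant of the distance, which itself may jump
  set u : ℝ → ℝ := fun s => a + ‖∫ r in (0 : ℝ)..s, (V' r - V r)‖
  have hu : ContinuousOn u (Icc 0 T) := by
    have := intervalIntegral.continuousOn_primitive_interval' hVV left_mem_uIcc
    rw [uIcc_of_le hT] at this
    exact continuousOn_const.add this.norm
  have hu0 : ∀ s ∈ Icc 0 T, 0 ≤ u s := fun s _ => add_nonneg ha (norm_nonneg _)
  have hyu : ∀ s ∈ Icc 0 T, ‖y' s - y s‖ ≤ u s := fun s hs => by
    have := norm_le_norm_sub_add (y' s - y s) (∫ r in (0 : ℝ)..s, (V' r - V r))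
    linarith [hdefect s hs]
  refine (hyu t ht).trans (h.le_psiInv_of_le_integral (by positivity) hK hu hu0 (fun s hs => ?_) ht)
  have hsub := uIcc_subset_uIcc_zero ⟨le_rfl, hT⟩ hs
  have hF : IntervalIntegrable (fun r => K * (u r + ω (u r))) volume 0 s := by
    refine ((h.continuousOn_add_comp hu hu0).const_smul K).mono ?_ |>.intervalIntegrable
    rw [uIcc_of_le hs.1]
    exact Icc_subset_Icc_right hs.2
  have h_int : ∫ r in (0 : ℝ)..s, ‖V' r - V r‖ ≤
      ∫ r in (0 : ℝ)..s, (e + K * (u r + ω (u r))) := by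
    refine intervalIntegral.integral_mono_on_of_le_Ioo hs.1 (hVV.mono_set hsub).norm
      (intervalIntegrable_const.add hF) fun r hr => ?_
    have hrT : r ∈ Ioo 0 T := ⟨hr.1, hr.2.trans_le hs.2⟩
    have hyr := hyu r (Ioo_subset_Icc_self hrT)
    have := h.mono hyr
    exact (hle r hrT).trans (by gcongr)
  rw [intervalIntegral.integral_add intervalIntegrable_const hF,
    intervalIntegral.integral_const, smul_eq_mul, sub_zero, mul_comm] at h_int
  have h_norm := intervalIntegral.norm_integral_le_integral_norm (f := fun r => V' r - V r)
    (μ := volume) hs.1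
  have h_es : e * s ≤ e * T := mul_le_mul_of_nonneg_left hs.2 he
  linarith

end Comparison

section Solutions

variable {d : ℕ} {Ω : Set (Pt d)} {ω K : ℝ → ℝ} {v v' : ℝ → Pt d → Pt d} {x : Pt d} {T : ℝ}
  {y y' : ℝ → Pt d}

lemma IsSolution.mono {S : ℝ} (h : IsSolution Ω v x T y) (hS : S ∈ Icc 0 T) :
    IsSolution Ω v x S y where
  mem_interior t ht := h.mem_interior t ⟨ht.1, ht.2.trans_le hS.2⟩
  integrable := h.integrable.mono_set (uIcc_subset_uIcc_zero ⟨le_rfl, hS.1.trans hS.2⟩ hS)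
  eq_integral t ht := h.eq_integral t ⟨ht.1, ht.2.trans hS.2⟩

lemma IsInwardField.isInwardPath (hv : IsInwardField Ω ω K v) (h : IsSolution Ω v x T y)
    (hT : T ≤ 1) : IsInwardPath Ω T x (fun s => v s (y s)) y where
  integrable := h.integrable
  eq_integral := h.eq_integral
  target_mem s hs := (hv.mem_admissible s ⟨hs.1.le, hs.2.le.trans hT⟩ _
    (h.mem_interior s (Ioo_subset_Ico_self hs))).2

/-- The reversed path is inward because `z - t • v t z` lies in `Ω` as well. -/
lemma IsInwardField.isInwardPath_reverse (hv : IsInwardField Ω ω K v)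
    (h : IsSolution Ω v x 1 y) :
    IsInwardPath Ω 1 (y 1) (fun s => -v (1 - s) (y (1 - s))) (fun s => y (1 - s)) where
  integrable := by
    have := (h.integrable.comp_sub_left 1).symm
    rw [sub_zero, sub_self] at this
    exact this.neg
  eq_integral t ht := by
    have ht' : 1 - t ∈ Icc (0 : ℝ) 1 := ⟨by linarith [ht.2], by linarith [ht.1]⟩
    rw [intervalIntegral.integral_neg,
      intervalIntegral.integral_comp_sub_left (fun s => v s (y s)) 1, sub_zero,
      h.eq_integral 1 ⟨zero_le_one, le_rfl⟩, h.eq_integral _ ht',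
      ← intervalIntegral.integral_interval_sub_left h.integrable (h.mono ht').integrable]
    abel
  target_mem t ht := by
    have ht' : 1 - t ∈ Ioo (0 : ℝ) 1 := ⟨by linarith [ht.2], by linarith [ht.1]⟩
    have := (hv.mem_admissible _ (Ioo_subset_Icc_self ht') _
      (h.mem_interior _ (Ioo_subset_Ico_self ht'))).1
    rwa [smul_neg, ← sub_eq_add_neg]

lemma IsInwardField.closedBall_min_subset (hv : IsInwardField Ω ω K v) (hc : Convex ℝ Ω)
    (hcl : IsClosed Ω) {ε γ : ℝ} (hε : 0 ≤ ε) (hγ : 0 < γ) (hx : Metric.closedBall x ε ⊆ Ω)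
    (h : IsSolution Ω v x 1 y) (hend : 2 * γ ≤ Metric.infDist (y 1) (frontier Ω)) {t : ℝ}
    (ht : t ∈ Icc (0 : ℝ) 1) : Metric.closedBall (y t) (min ε γ / 2) ⊆ Ω := by
  have hne : Ω.Nonempty := ⟨x, hx (Metric.mem_closedBall_self hε)⟩
  have h_start : ∀ s ∈ Icc (0 : ℝ) 1, Metric.closedBall (y s) ((1 - s) * ε) ⊆ Ω := fun s hs =>
    (hv.isInwardPath h le_rfl).closedBall_subset hc hcl hne le_rfl hx hs
  have h_end : Metric.closedBall (y 1) γ ⊆ Ω := closedBall_subset_of_lt_infDist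
    (h_start 1 ⟨zero_le_one, le_rfl⟩ (Metric.mem_closedBall_self (by simp))) hγ.le (by linarith)
  have hε_min := min_le_left ε γ
  have hγ_min := min_le_right ε γ
  rcases le_total t (1 / 2) with ht2 | ht2
  · exact (Metric.closedBall_subset_closedBall (by nlinarith)).trans (h_start t ht)
  · have := (hv.isInwardPath_reverse h).closedBall_subset hc hcl hne le_rfl h_end
      (t := 1 - t) ⟨by linarith [ht.2], by linarith [ht.1]⟩
    simp only [sub_sub_cancel] at this
    exact (Metric.closedBall_subset_closedBall (by nlinarith)).trans this

lemma IsInwardField.norm_sub_le_psiInv (hv : IsInwardField Ω ω K v) (hω : IsOsgoodModulus ω)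
    (hT : T ∈ Icc (0 : ℝ) 1) {ρ e : ℝ} (hρ : 0 < ρ)
    (hball : ∀ t ∈ Ioo 0 T, Metric.closedBall (y t) ρ ⊆ Ω) (he : 0 ≤ e)
    (hle : ∀ t ∈ Icc (0 : ℝ) 1, ∀ z ∈ interior Ω, ‖v t z - v' t z‖ ≤ e)
    (h : IsSolution Ω v x T y) (h' : IsSolution Ω v' x T y') :
    ‖y' T - y T‖ ≤ psiInv ω (psi ω (e * T) + (K ρ * T : ℝ)) := by
  rw [← zero_add (e * T)]
  refine hω.norm_sub_le_psiInv le_rfl he (hv.nonneg ρ hρ) h.integrable h'.integrable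
    (fun t ht => ?_) (fun s hs => ?_) ⟨hT.1, le_rfl⟩
  · rw [intervalIntegral.integral_sub (h'.mono ht).integrable (h.mono ht).integrable,
      h.eq_integral t ht, h'.eq_integral t ht, add_sub_add_left_eq_sub, sub_self, norm_zero]
  · have hs1 : s ∈ Icc (0 : ℝ) 1 := ⟨hs.1.le, hs.2.le.trans hT.2⟩
    have h_field := hle s hs1 _ (h'.mem_interior s (Ioo_subset_Ico_self hs))
    have h_osc := hv.norm_sub_le s hs1 ρ hρ (y s) (hball s hs) (y' s)
    rw [norm_sub_rev] at h_field
    exact (norm_sub_le_norm_sub_add_norm_sub _ (v s (y' s)) _).trans (add_le_add h_field h_osc)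

lemma IsInwardField.eqOn_of_isSolution (hv : IsInwardField Ω ω K v) (hω : IsOsgoodModulus ω)
    (hc : Convex ℝ Ω) (hcl : IsClosed Ω) (hx : x ∈ interior Ω) (hT : T ≤ 1)
    (h : IsSolution Ω v x T y) (h' : IsSolution Ω v x T y') : EqOn y' y (Icc 0 T) := by
  obtain ⟨ε, hε, hxε⟩ := exists_closedBall_subset hx
  have h_lt : ∀ t ∈ Icc 0 T, t < 1 → y' t = y t := by
    intro t ht ht1
    have ht1' : 0 < 1 - t := sub_pos.2 ht1
    have hball : ∀ s ∈ Ioo 0 t, Metric.closedBall (y s) ((1 - t) * ε) ⊆ Ω := fun s hs =>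
      (Metric.closedBall_subset_closedBall (by gcongr; exact hs.2.le)).trans
        ((hv.isInwardPath h hT).closedBall_subset hc hcl ⟨x, interior_subset hx⟩ hT hxε
          ⟨hs.1.le, hs.2.le.trans ht.2⟩)
    have := hv.norm_sub_le_psiInv hω ⟨ht.1, ht1.le⟩ (mul_pos ht1' hε) hball le_rfl
      (fun _ _ _ _ => by simp) (h.mono ht) (h'.mono ht)
    rwa [zero_mul, psiInv_psi_zero_add, norm_le_zero_iff, sub_eq_zero] at this
  intro t ht
  rw [h.eq_integral t ht, h'.eq_integral t ht]
  congr 1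
  refine intervalIntegral.integral_congr_Ioo_of_le ht.1 fun s hs => ?_
  rw [h_lt s ⟨hs.1.le, hs.2.le.trans ht.2⟩ (hs.2.trans_le (ht.2.trans hT))]

end Solutions

section Composition

variable {E : Type*} [NormedAddCommGroup E] [MeasurableSpace E] [BorelSpace E]
  [SecondCountableTopology E] {v : ℝ → E → E} {x : E} {D : ℝ}

lemma intervalIntegrable_comp (hv : Measurable fun q : ℝ × E => v q.1 q.2)
    (hD : ∀ t z, ‖v t z‖ ≤ D) {y : ℝ → E} (hy : Measurable y) (a b : ℝ) :
    IntervalIntegrable (fun s => v s (y s)) volume a b := by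
  have hm : Measurable fun s => v s (y s) := hv.comp (measurable_id.prodMk hy)
  refine (intervalIntegrable_const (c := D)).mono_fun hm.aestronglyMeasurable
    (Eventually.of_forall fun s => ?_)
  exact (hD s (y s)).trans (le_abs_self D)

lemma intervalIntegrable_comp_of_tendsto (hv : Measurable fun q : ℝ × E => v q.1 q.2)
    (hD : ∀ t z, ‖v t z‖ ≤ D) {y : ℕ → ℝ → E} (hy : ∀ n, Measurable (y n)) {Y : ℝ → E} {a b : ℝ}
    (hlim : ∀ᵐ s, s ∈ uIoc a b → Tendsto (fun n => v s (y n s)) atTop (𝓝 (v s (Y s)))) :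
    IntervalIntegrable (fun s => v s (Y s)) volume a b := by
  refine (intervalIntegrable_const (c := D)).mono_fun ?_
    (Eventually.of_forall fun s => (hD s (Y s)).trans (le_abs_self D))
  exact aestronglyMeasurable_of_tendsto_ae atTop
    (fun n => (hv.comp (measurable_id.prodMk (hy n))).aestronglyMeasurable)
    ((ae_restrict_iff' measurableSet_uIoc).2 hlim)

lemma eq_add_integral_of_tendsto [NormedSpace ℝ E] (hv : Measurable fun q : ℝ × E => v q.1 q.2)
    (hD : ∀ t z, ‖v t z‖ ≤ D) {y : ℕ → ℝ → E} (hy : ∀ n, Measurable (y n)) {Y : ℝ → E} {t : ℝ}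
    (hlim : ∀ᵐ s, s ∈ uIoc 0 t → Tendsto (fun n => v s (y n s)) atTop (𝓝 (v s (Y s))))
    (hlim_t : Tendsto (fun n => y n t) atTop (𝓝 (Y t)))
    (hdefect : Tendsto (fun n => y n t - x - ∫ s in (0 : ℝ)..t, v s (y n s)) atTop (𝓝 0)) :
    Y t = x + ∫ s in (0 : ℝ)..t, v s (Y s) := by
  have h_int : Tendsto (fun n => ∫ s in (0 : ℝ)..t, v s (y n s)) atTop
      (𝓝 (∫ s in (0 : ℝ)..t, v s (Y s))) :=
    intervalIntegral.tendsto_integral_filter_of_dominated_convergence (fun _ => D)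
      (Eventually.of_forall fun n => (hv.comp (measurable_id.prodMk (hy n))).aestronglyMeasurable)
      (Eventually.of_forall fun n => Eventually.of_forall fun s _ => hD s _)
      intervalIntegrable_const hlim
  have h_zero := tendsto_nhds_unique hdefect ((hlim_t.sub_const x).sub h_int)
  rwa [sub_sub, eq_comm, sub_eq_zero] at h_zero

end Composition

section Euler

variable {E : Type*} [NormedAddCommGroup E] [NormedSpace ℝ E]

/-- The Euler scheme with step `h` for the field `v`, started at `x`. On each time step the space
variable is frozen but the time variable is integrated, so that `v` need only be measurable in
time. -/
noncomputable def eulerNode (v : ℝ → E → E) (x : E) (h : ℝ) : ℕ → E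
  | 0 => x
  | k + 1 => eulerNode v x h k + ∫ s in (k * h)..((k + 1) * h), v s (eulerNode v x h k)

/-- The piecewise constant path through the nodes of the Euler scheme with step `h`. -/
noncomputable def eulerPath (v : ℝ → E → E) (x : E) (h t : ℝ) : E :=
  eulerNode v x h ⌊t / h⌋₊

variable {v : ℝ → E → E} {x : E} {h : ℝ}

lemma eulerPath_of_mem (hh : 0 < h) {k : ℕ} {t : ℝ} (ht : t ∈ Ico (k * h) ((k + 1) * h)) :
    eulerPath v x h t = eulerNode v x h k := by
  have h_nonneg : 0 ≤ t / h := div_nonneg ((by positivity : (0 : ℝ) ≤ k * h).trans ht.1) hh.le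
  have h_floor : ⌊t / h⌋₊ = k := by
    rw [Nat.floor_eq_iff h_nonneg, le_div_iff₀ hh, div_lt_iff₀ hh]
    exact ht
  rw [eulerPath, h_floor]

lemma floor_div_mul_le (hh : 0 < h) {t : ℝ} (ht : 0 ≤ t) : ⌊t / h⌋₊ * h ≤ t := by
  rw [← le_div_iff₀ hh]
  exact Nat.floor_le (div_nonneg ht hh.le)

variable [MeasurableSpace E]

lemma measurable_eulerPath (v : ℝ → E → E) (x : E) (h : ℝ) : Measurable (eulerPath v x h) :=
  (measurable_from_nat (f := eulerNode v x h)).comp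
    (Nat.measurable_floor.comp (measurable_id.div_const h))

variable [BorelSpace E] [SecondCountableTopology E] {D : ℝ}

lemma eulerNode_eq (hv : Measurable fun q : ℝ × E => v q.1 q.2) (hD : ∀ t z, ‖v t z‖ ≤ D)
    (hh : 0 < h) (k : ℕ) :
    eulerNode v x h k = x + ∫ s in (0 : ℝ)..(k * h), v s (eulerPath v x h s) := by
  have hi := intervalIntegrable_comp hv hD (measurable_eulerPath v x h)
  induction k with
  | zero => simp [eulerNode]
  | succ k ih =>
    rw [eulerNode, Nat.cast_succ, ← intervalIntegral.integral_add_adjacent_intervals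
      (hi 0 (k * h)) (hi (k * h) ((k + 1) * h)), ← add_assoc, ← ih]
    congr 1
    refine intervalIntegral.integral_congr_Ioo_of_le (by nlinarith) fun s hs => ?_
    rw [eulerPath_of_mem hh ⟨hs.1.le, hs.2⟩]

lemma norm_eulerPath_sub_le (hv : Measurable fun q : ℝ × E => v q.1 q.2)
    (hD : ∀ t z, ‖v t z‖ ≤ D) (hh : 0 < h) {t : ℝ} (ht : 0 ≤ t) :
    ‖eulerPath v x h t - x - ∫ s in (0 : ℝ)..t, v s (eulerPath v x h s)‖ ≤ D * h := by
  have hi := intervalIntegrable_comp hv hD (measurable_eulerPath v x h)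
  have hD0 : 0 ≤ D := (norm_nonneg _).trans (hD 0 0)
  set k := ⌊t / h⌋₊ with hk
  have hkt : k * h ≤ t := floor_div_mul_le hh ht
  have htk : t ≤ (k + 1) * h := by
    rw [← div_le_iff₀ hh]
    exact (Nat.lt_floor_add_one _).le
  have h_defect : eulerPath v x h t - x - ∫ s in (0 : ℝ)..t, v s (eulerPath v x h s)
      = -∫ s in (k * h)..t, v s (eulerPath v x h s) := by
    rw [eulerPath, ← hk, eulerNode_eq hv hD hh k,
      ← intervalIntegral.integral_interval_sub_left (hi 0 t) (hi 0 (k * h))]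
    abel
  rw [h_defect, norm_neg]
  refine (intervalIntegral.norm_integral_le_of_norm_le_const fun s _ => hD s _).trans ?_
  rw [abs_of_nonneg (sub_nonneg.2 hkt)]
  exact mul_le_mul_of_nonneg_left (by linarith) hD0

lemma norm_eulerPath_sub_eulerPath_sub_le (hv : Measurable fun q : ℝ × E => v q.1 q.2)
    (hD : ∀ t z, ‖v t z‖ ≤ D) {h' : ℝ} (hh : 0 < h) (hh' : 0 < h') {t : ℝ} (ht : 0 ≤ t) :
    ‖eulerPath v x h' t - eulerPath v x h t - ∫ s in (0 : ℝ)..t,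
      (v s (eulerPath v x h' s) - v s (eulerPath v x h s))‖ ≤ D * h' + D * h := by
  rw [intervalIntegral.integral_sub
    (intervalIntegrable_comp hv hD (measurable_eulerPath v x h') 0 t)
    (intervalIntegrable_comp hv hD (measurable_eulerPath v x h) 0 t)]
  refine le_trans (le_of_eq ?_) ((norm_sub_le _ _).trans (add_le_add
    (norm_eulerPath_sub_le (x := x) hv hD hh' ht) (norm_eulerPath_sub_le (x := x) hv hD hh ht)))
  congr 1
  abel

end Euler

section EulerInvariance

lemma add_smul_inv_smul_integral_mem {E : Type*} [NormedAddCommGroup E] [NormedSpace ℝ E]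
    [CompleteSpace E] {s : Set E} (hs : Convex ℝ s) (hcl : IsClosed s) {z : E} {c a b : ℝ}
    {f : ℝ → E} (hab : a < b) (hf : IntervalIntegrable f volume a b)
    (hmem : ∀ r ∈ Ioc a b, z + c • f r ∈ s) :
    z + c • (b - a)⁻¹ • ∫ r in a..b, f r ∈ s := by
  have h_conv : Convex ℝ {w : E | z + c • w ∈ s} := (hs.translate_preimage_right z).smul_preimage c
  have h_closed : IsClosed {w : E | z + c • w ∈ s} := hcl.preimage (by fun_prop)
  rw [← interval_average_eq, uIoc_of_le hab.le]
  refine h_conv.set_average_mem h_closed (by simp [hab]) (by simp) ?_ hf.1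
  filter_upwards [ae_restrict_mem measurableSet_Ioc] with r hr using hmem r hr

lemma exp_neg_two_mul_le {l : ℝ} (h0 : 0 ≤ l) (h1 : l ≤ 1 / 2) : Real.exp (-(2 * l)) ≤ 1 - l := by
  rw [Real.exp_neg, inv_le_comm₀ (Real.exp_pos _) (by linarith)]
  refine le_trans ?_ (Real.add_one_le_exp (2 * l))
  rw [inv_le_iff_one_le_mul₀ (by linarith)]
  nlinarith

variable {d : ℕ} {Ω : Set (Pt d)} {ω K : ℝ → ℝ} {v : ℝ → Pt d → Pt d} {x : Pt d} {ε T h : ℝ}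

/-- The witness `w` is the point reached from the node after time `1 - T` at the average velocity of
the step. -/
lemma IsInwardField.exists_eulerNode_succ_eq (hv : IsInwardField Ω ω K v) (hc : Convex ℝ Ω)
    (hcl : IsClosed Ω) (hT : T < 1) (hh : 0 < h) {k : ℕ} (hk : (k + 1) * h ≤ T)
    (hz : eulerNode v x h k ∈ interior Ω) :
    ∃ w ∈ Ω, eulerNode v x h (k + 1)
      = (1 - h / (1 - T)) • eulerNode v x h k + (h / (1 - T)) • w := by
  have hT1 : 0 < 1 - T := sub_pos.2 hT
  have hk0 : 0 ≤ k * h := by positivity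
  have hk_len : (k + 1) * h - k * h = h := by ring
  set z := eulerNode v x h k with hz_def
  have hk_lt : k * h < (k + 1) * h := by linarith
  have h_int : IntervalIntegrable (fun s => v s z) volume (k * h) ((k + 1) * h) :=
    intervalIntegrable_comp hv.measurable hv.norm_le measurable_const _ _
  refine ⟨_, add_smul_inv_smul_integral_mem hc hcl (z := z) (c := 1 - T) hk_lt h_int
    fun s hs => ?_, ?_⟩
  · have hsT : s ≤ T := hs.2.trans hk
    have hs1 : 0 < 1 - s := by linarith
    have h_target := (hv.mem_admissible s ⟨hk0.trans hs.1.le, by linarith⟩ z hz).2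
    have := hc.add_smul_mem (interior_subset hz) h_target (t := (1 - T) / (1 - s))
      ⟨by positivity, (div_le_one hs1).2 (by linarith)⟩
    rwa [smul_smul, div_mul_cancel₀ _ hs1.ne'] at this
  · have h_scale : h / (1 - T) * ((1 - T) * h⁻¹) = 1 := by field_simp
    rw [eulerNode, ← hz_def, hk_len, smul_add, smul_smul, smul_smul, mul_assoc, h_scale]
    module

lemma IsInwardField.closedBall_eulerNode_subset (hv : IsInwardField Ω ω K v) (hc : Convex ℝ Ω)
    (hcl : IsClosed Ω) (hε : 0 < ε) (hx : Metric.closedBall x ε ⊆ Ω) (hT : T < 1) (hh : 0 < h)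
    (hhT : h ≤ (1 - T) / 2) (k : ℕ) (hk : k * h ≤ T) :
    Metric.closedBall (eulerNode v x h k) (ε * (1 - h / (1 - T)) ^ k) ⊆ Ω := by
  have hT1 : 0 < 1 - T := sub_pos.2 hT
  have hl1 : 0 < 1 - h / (1 - T) := sub_pos.2 ((div_lt_one hT1).2 (by linarith))
  induction k with
  | zero => simpa [eulerNode] using hx
  | succ k ih =>
    push_cast at hk
    have ih := ih (by linarith)
    obtain ⟨w, hw, hw_eq⟩ := hv.exists_eulerNode_succ_eq hc hcl hT hh hk
      (mem_interior_of_closedBall_subset (by positivity) ih)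
    rw [hw_eq, pow_succ', mul_left_comm]
    exact closedBall_combo_subset hc ih hw ⟨by positivity, (sub_pos.1 hl1).le⟩

lemma IsInwardField.closedBall_eulerPath_subset (hv : IsInwardField Ω ω K v) (hc : Convex ℝ Ω)
    (hcl : IsClosed Ω) (hε : 0 < ε) (hx : Metric.closedBall x ε ⊆ Ω) (hT : T < 1) (hh : 0 < h)
    (hhT : h ≤ (1 - T) / 2) {t : ℝ} (ht : t ∈ Icc 0 T) :
    Metric.closedBall (eulerPath v x h t) (ε * Real.exp (-(2 / (1 - T)))) ⊆ Ω := by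
  have hT1 : 0 < 1 - T := sub_pos.2 hT
  have hkT : ⌊t / h⌋₊ * h ≤ T := (floor_div_mul_le hh ht.1).trans ht.2
  refine (Metric.closedBall_subset_closedBall (mul_le_mul_of_nonneg_left ?_ hε.le)).trans
    (hv.closedBall_eulerNode_subset hc hcl hε hx hT hh hhT ⌊t / h⌋₊ hkT)
  have h_step := exp_neg_two_mul_le (l := h / (1 - T)) (by positivity)
    (by rw [div_le_iff₀ hT1]; linarith)
  calc Real.exp (-(2 / (1 - T)))
      ≤ Real.exp (⌊t / h⌋₊ * -(2 * (h / (1 - T)))) := by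
        refine Real.exp_le_exp.2 ?_
        rw [mul_neg, neg_le_neg_iff, show ⌊t / h⌋₊ * (2 * (h / (1 - T)))
          = 2 * (⌊t / h⌋₊ * h) / (1 - T) by ring]
        exact div_le_div_of_nonneg_right (by linarith) hT1.le
    _ = Real.exp (-(2 * (h / (1 - T)))) ^ ⌊t / h⌋₊ := Real.exp_nat_mul _ _
    _ ≤ (1 - h / (1 - T)) ^ ⌊t / h⌋₊ := by gcongr

end EulerInvariance

section Existence

variable {d : ℕ} {Ω : Set (Pt d)} {ω K : ℝ → ℝ} {v : ℝ → Pt d → Pt d} {x : Pt d}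

lemma IsInwardField.exists_norm_eulerPath_sub_le (hv : IsInwardField Ω ω K v)
    (hω : IsOsgoodModulus ω) (hc : Convex ℝ Ω) (hcl : IsClosed Ω) (hx : x ∈ interior Ω) {T : ℝ}
    (hT : T < 1) {θ : ℝ} (hθ : 0 < θ) :
    ∃ η > 0, ∀ h h' : ℝ, 0 < h → h ≤ η → 0 < h' → h' ≤ η → ∀ t ∈ Icc 0 T,
      ‖eulerPath v x h' t - eulerPath v x h t‖ ≤ θ := by
  obtain ⟨ε, hε, hxε⟩ := exists_closedBall_subset hx
  have : 0 < 1 - T := sub_pos.2 hT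
  set ρ := ε * Real.exp (-(2 / (1 - T)))
  have hρ : 0 < ρ := by positivity
  have : 0 ≤ Metric.diam Ω := Metric.diam_nonneg
  have hK := hv.nonneg ρ hρ
  obtain ⟨a, ha, haθ⟩ := hω.exists_psiInv_psi_add_le (K ρ * T) hθ
  refine ⟨min ((1 - T) / 2) (a / (2 * Metric.diam Ω + 1)), by positivity, ?_⟩
  intro h h' hh hhη hh' hhη' t ht
  rw [le_min_iff, le_div_iff₀ (by positivity : 0 < 2 * Metric.diam Ω + 1)] at hhη hhη'
  have hball : ∀ s ∈ Icc 0 T, Metric.closedBall (eulerPath v x h s) ρ ⊆ Ω := fun s hs =>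
    hv.closedBall_eulerPath_subset hc hcl hε hxε hT hh hhη.1 hs
  refine (hω.norm_sub_le_psiInv ha.le le_rfl hK
    (intervalIntegrable_comp hv.measurable hv.norm_le (measurable_eulerPath v x h) 0 T)
    (intervalIntegrable_comp hv.measurable hv.norm_le (measurable_eulerPath v x h') 0 T)
    (fun s hs => ?_) (fun s hs => ?_) ht).trans (le_trans ?_ haθ)
  · refine (norm_eulerPath_sub_eulerPath_sub_le hv.measurable hv.norm_le hh hh' hs.1).trans ?_
    nlinarith
  · rw [zero_add]
    exact hv.norm_sub_le s ⟨hs.1.le, hs.2.le.trans hT.le⟩ ρ hρ _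
      (hball s (Ioo_subset_Icc_self hs)) _
  · rw [zero_mul, add_zero]
    exact hω.psiInv_psi_add_mono le_rfl (mul_le_mul_of_nonneg_left ht.2 hK)

lemma IsInwardField.continuousAt (hv : IsInwardField Ω ω K v) (hω : IsOsgoodModulus ω) {t : ℝ}
    (ht : t ∈ Icc (0 : ℝ) 1) {z : Pt d} (hz : z ∈ interior Ω) : ContinuousAt (v t) z := by
  obtain ⟨ρ, hρ, hball⟩ := exists_closedBall_subset hz
  have h_modulus : ∀ᶠ u in 𝓝[>] (0 : ℝ), 0 < u := self_mem_nhdsWithin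
  have h_tendsto : Tendsto (fun u => K ρ * (u + ω u)) (𝓝[>] 0) (𝓝 0) := by
    have := ((tendsto_nhdsWithin_of_tendsto_nhds tendsto_id).add
      (hω.osgood.tendsto_zero hω.mono hω.nonneg)).const_mul (K ρ)
    simpa using this
  rw [ContinuousAt, Metric.tendsto_nhds]
  intro c hc
  obtain ⟨u, hu, hu0⟩ := ((h_tendsto.eventually_lt_const hc).and h_modulus).exists
  filter_upwards [Metric.ball_mem_nhds z hu0] with w hw
  rw [Metric.mem_ball, dist_eq_norm] at hw
  rw [dist_eq_norm]
  exact ((hv.norm_sub_le t ht ρ hρ z hball w).trans (mul_le_mul_of_nonneg_left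
    (add_le_add hw.le (hω.mono hw.le)) (hv.nonneg ρ hρ))).trans_lt hu

lemma IsInwardField.exists_tendsto_eulerPath (hv : IsInwardField Ω ω K v)
    (hω : IsOsgoodModulus ω) (hc : Convex ℝ Ω) (hcl : IsClosed Ω) (hx : x ∈ interior Ω)
    {h : ℕ → ℝ} (hpos : ∀ n, 0 < h n) (hlim : Tendsto h atTop (𝓝 0)) {t : ℝ}
    (ht : t ∈ Ico (0 : ℝ) 1) :
    ∃ l ∈ interior Ω, Tendsto (fun n => eulerPath v x (h n) t) atTop (𝓝 l) := by
  obtain ⟨ε, hε, hxε⟩ := exists_closedBall_subset hx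
  have ht_mem : t ∈ Icc 0 t := ⟨ht.1, le_rfl⟩
  have h_cauchy : CauchySeq fun n => eulerPath v x (h n) t := by
    rw [Metric.cauchySeq_iff]
    intro θ hθ
    obtain ⟨η, hη, h_close⟩ :=
      hv.exists_norm_eulerPath_sub_le hω hc hcl hx ht.2 (half_pos hθ)
    obtain ⟨N, hN⟩ := eventually_atTop.1 (hlim.eventually_le_const hη)
    refine ⟨N, fun m hm n hn => ?_⟩
    rw [dist_eq_norm]
    exact (h_close (h n) (h m) (hpos n) (hN n hn) (hpos m) (hN m hm) t ht_mem).trans_lt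
      (half_lt_self hθ)
  obtain ⟨l, hl⟩ := cauchySeq_tendsto_of_complete h_cauchy
  refine ⟨l, mem_interior_of_closedBall_subset
    (by positivity : 0 < ε * Real.exp (-(2 / (1 - t)))) fun w hw => ?_, hl⟩
  have h_shift := hl.add_const (w - l)
  rw [add_sub_cancel] at h_shift
  refine hcl.mem_of_tendsto h_shift ?_
  filter_upwards [hlim.eventually_le_const (half_pos (sub_pos.2 ht.2))] with n hn
  refine hv.closedBall_eulerPath_subset hc hcl hε hxε ht.2 (hpos n) hn ht_mem ?_
  rw [mem_closedBall_iff_norm] at hw ⊢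
  rwa [add_sub_cancel_left]

/-- `Y 1` is arbitrary, so the end value of the solution is read off the integral. -/
lemma isSolution_of_eq_integral_Ico {Y : ℝ → Pt d}
    (hint : IntervalIntegrable (fun s => v s (Y s)) volume 0 1)
    (hmem : ∀ t ∈ Ico (0 : ℝ) 1, Y t ∈ interior Ω)
    (heq : ∀ t ∈ Ico (0 : ℝ) 1, Y t = x + ∫ s in (0 : ℝ)..t, v s (Y s)) :
    IsSolution Ω v x 1 fun t => x + ∫ s in (0 : ℝ)..t, v s (Y s) where
  mem_interior t ht := heq t ht ▸ hmem t ht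
  integrable := by
    refine hint.congr_ae ((ae_restrict_iff' measurableSet_uIoc).2 ?_)
    filter_upwards [Measure.ae_ne volume (1 : ℝ)] with s hs hs_mem
    rw [uIoc_of_le zero_le_one] at hs_mem
    rw [← heq s ⟨hs_mem.1.le, lt_of_le_of_ne hs_mem.2 hs⟩]
  eq_integral t ht := by
    refine congrArg (x + ·) (intervalIntegral.integral_congr_Ioo_of_le ht.1 fun s hs => ?_)
    exact congrArg (v s) (heq s ⟨hs.1.le, hs.2.trans_le ht.2⟩)

lemma IsInwardField.exists_isSolution (hv : IsInwardField Ω ω K v) (hω : IsOsgoodModulus ω)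
    (hc : Convex ℝ Ω) (hcl : IsClosed Ω) (hx : x ∈ interior Ω) :
    ∃ y, IsSolution Ω v x 1 y := by
  set h : ℕ → ℝ := fun n => 1 / ((n : ℝ) + 1)
  have hpos : ∀ n, 0 < h n := fun n => Nat.one_div_pos_of_nat
  have hlim : Tendsto h atTop (𝓝 0) := tendsto_one_div_add_atTop_nhds_zero_nat
  have h_ex : ∀ t, ∃ l, t ∈ Ico (0 : ℝ) 1 → l ∈ interior Ω ∧
      Tendsto (fun n => eulerPath v x (h n) t) atTop (𝓝 l) := fun t => by
    by_cases ht : t ∈ Ico (0 : ℝ) 1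
    · exact (hv.exists_tendsto_eulerPath hω hc hcl hx hpos hlim ht).imp fun _ hl _ => hl
    · exact ⟨0, fun ht' => absurd ht' ht⟩
  choose Y hY using h_ex
  have h_field : ∀ t ∈ Icc (0 : ℝ) 1, ∀ᵐ s, s ∈ uIoc 0 t →
      Tendsto (fun n => v s (eulerPath v x (h n) s)) atTop (𝓝 (v s (Y s))) := by
    intro t ht
    filter_upwards [Measure.ae_ne volume (1 : ℝ)] with s hs hst
    rw [uIoc_of_le ht.1] at hst
    have hs1 : s < 1 := lt_of_le_of_ne (hst.2.trans ht.2) hs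
    have hYs := hY s ⟨hst.1.le, hs1⟩
    exact (hv.continuousAt hω ⟨hst.1.le, hs1.le⟩ hYs.1).tendsto.comp hYs.2
  have h_meas : ∀ n, Measurable (eulerPath v x (h n)) := fun n => measurable_eulerPath v x (h n)
  refine ⟨_, isSolution_of_eq_integral_Ico (intervalIntegrable_comp_of_tendsto hv.measurable
    hv.norm_le h_meas (h_field 1 ⟨zero_le_one, le_rfl⟩)) (fun t ht => (hY t ht).1) fun t ht =>
    eq_add_integral_of_tendsto hv.measurable hv.norm_le h_meas (h_field t ⟨ht.1, ht.2.le⟩)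
      (hY t ht).2 ?_⟩
  refine squeeze_zero_norm (fun n =>
    norm_eulerPath_sub_le hv.measurable hv.norm_le (hpos n) ht.1) ?_
  simpa using hlim.const_mul (Metric.diam Ω)

lemma IsInwardField.hasUniqueFlow (hv : IsInwardField Ω ω K v) (hω : IsOsgoodModulus ω)
    (hc : Convex ℝ Ω) (hcl : IsClosed Ω) (hx : x ∈ interior Ω) : HasUniqueFlow Ω v x := by
  obtain ⟨y, hy⟩ := hv.exists_isSolution hω hc hcl hx
  exact ⟨y, hy, fun T hT _ hy' =>
    hv.eqOn_of_isSolution hω hc hcl hx hT.2 (hy.mono ⟨hT.1.le, hT.2⟩) hy'⟩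

end Existence

section Stability

variable {d : ℕ} {Ω : Set (Pt d)} {lo hi lo' hi' r ε γ : ℝ} {p₀ p₁ q₀ q₁ : Pt d → ℝ}

lemma logRatio_nonneg (p₀ p₁ q₀ q₁ : Pt d → ℝ) (x : Pt d) : 0 ≤ logRatio p₀ p₁ q₀ q₁ x :=
  (abs_nonneg _).trans (le_max_left _ _)

lemma logRatioError_nonneg (Ω : Set (Pt d)) (p₀ p₁ q₀ q₁ : Pt d → ℝ) :
    0 ≤ logRatioError Ω p₀ p₁ q₀ q₁ :=
  Real.sSup_nonneg (forall_mem_image.2 fun _ _ => logRatio_nonneg _ _ _ _ _)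

lemma mem_Icc_of_abs_log_div_le {a b : ℝ} (hlo : 0 < lo) (ha : a ∈ Icc lo hi) (hb : 0 < b)
    (h : |Real.log (b / a)| ≤ r) : b ∈ Icc (lo * Real.exp (-r)) (hi * Real.exp r) := by
  have ha_pos : 0 < a := hlo.trans_le ha.1
  rw [abs_le, Real.le_log_iff_exp_le (div_pos hb ha_pos),
    Real.log_le_iff_le_exp (div_pos hb ha_pos), le_div_iff₀' ha_pos, div_le_iff₀' ha_pos] at h
  exact ⟨(mul_le_mul_of_nonneg_right ha.1 (Real.exp_nonneg _)).trans h.1,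
    h.2.trans (mul_le_mul_of_nonneg_right ha.2 (Real.exp_nonneg _))⟩

lemma IsBoundedPair.of_logRatio_le (h : IsBoundedPair Ω lo hi p₀ p₁) (hq₀ : ∀ x ∈ Ω, 0 < q₀ x)
    (hq₁ : ∀ x ∈ Ω, 0 < q₁ x) (hr : ∀ x ∈ Ω, logRatio p₀ p₁ q₀ q₁ x ≤ r) :
    IsBoundedPair Ω (lo * Real.exp (-r)) (hi * Real.exp r) q₀ q₁ where
  lo_pos := mul_pos h.lo_pos (Real.exp_pos _)
  mem_Icc₀ x hx := mem_Icc_of_abs_log_div_le h.lo_pos (h.mem_Icc₀ x hx) (hq₀ x hx)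
    ((le_max_left _ _).trans (hr x hx))
  mem_Icc₁ x hx := mem_Icc_of_abs_log_div_le h.lo_pos (h.mem_Icc₁ x hx) (hq₁ x hx)
    ((le_max_right _ _).trans (hr x hx))

lemma IsBoundedPair.hasUniqueFlow_velocity (h : IsBoundedPair Ω lo hi p₀ p₁)
    (ho : IsOsgood (ratioModulus Ω p₀ p₁)) (hΩ : IsCompact Ω) (hc : Convex ℝ Ω) {x : Pt d}
    (hx : x ∈ interior Ω) : HasUniqueFlow Ω (velocity Ω p₀ p₁) x :=
  have hne : Ω.Nonempty := ⟨x, interior_subset hx⟩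
  ((h.isWeightPair ho).isInwardField hΩ hc hne).hasUniqueFlow (h.isOsgoodModulus hc hne ho) hc
    hΩ.isClosed hx

lemma IsBoundedPair.norm_sub_le_psiInv (hp : IsBoundedPair Ω lo hi p₀ p₁)
    (hpo : IsOsgood (ratioModulus Ω p₀ p₁)) (hq : IsBoundedPair Ω lo' hi' q₀ q₁)
    (hqo : IsOsgood (ratioModulus Ω q₀ q₁)) (hΩ : IsCompact Ω) (hc : Convex ℝ Ω)
    (hr : ∀ x ∈ Ω, logRatio p₀ p₁ q₀ q₁ x ≤ r) (hε : 0 < ε) (hγ : 0 < γ) {x : Pt d}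
    (hx : Metric.closedBall x ε ⊆ Ω) {y y' : ℝ → Pt d}
    (h : IsSolution Ω (velocity Ω p₀ p₁) x 1 y) (h' : IsSolution Ω (velocity Ω q₀ q₁) x 1 y')
    (hend : 2 * γ ≤ Metric.infDist (y 1) (frontier Ω)) :
    ‖y' 1 - y 1‖ ≤ psiInv (ratioModulus Ω p₀ p₁)
      (psi (ratioModulus Ω p₀ p₁) (2 * Metric.diam Ω * (Real.exp (2 * r) - 1)) +
        (oscConst d (Metric.diam Ω) lo hi (min ε γ / 2) : ℝ)) := by
  have hxΩ : x ∈ Ω := hx (Metric.mem_closedBall_self hε.le)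
  have hpw := hp.isWeightPair hpo
  have hv := hpw.isInwardField hΩ hc ⟨x, hxΩ⟩
  have hr_nonneg : 0 ≤ r := (logRatio_nonneg p₀ p₁ q₀ q₁ x).trans (hr x hxΩ)
  have he : 0 ≤ 2 * Metric.diam Ω * (Real.exp (2 * r) - 1) :=
    mul_nonneg (by positivity) (sub_nonneg.2 (Real.one_le_exp (by positivity)))
  simpa only [mul_one] using hv.norm_sub_le_psiInv (hp.isOsgoodModulus hc ⟨x, hxΩ⟩ hpo)
    (right_mem_Icc.2 zero_le_one) (half_pos (lt_min hε hγ))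
    (fun t ht => hv.closedBall_min_subset hc hΩ.isClosed hε.le hγ hx h hend
      (Ioo_subset_Icc_self ht))
    he (fun t ht z hz => norm_velocity_sub_velocity_le hpw (hq.isWeightPair hqo) hr hΩ ht hz) h h'

/-- The constant `C` of the stability estimate. The factor `1 / log 2` pays for the logarithm,
which is at least `log 2` because a ball of radius `ε` fits into the domain; `+ 1` makes the
constant positive even if `D = 0`. -/
noncomputable def stabilityConst (d : ℕ) (D lo hi : ℝ) : ℝ :=
  2 * |D| * |velocityConst d lo hi| * (|D| + 2) / Real.log 2 + 1

lemma stabilityConst_pos (d : ℕ) (D lo hi : ℝ) : 0 < stabilityConst d D lo hi := by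
  have := Real.log_pos one_lt_two
  unfold stabilityConst
  positivity

lemma oscConst_le_stabilityConst (d : ℕ) {D : ℝ} (lo hi : ℝ) (hε : 0 < ε) (hγ : 0 < γ)
    (hD : 2 * ε ≤ D) :
    oscConst d D lo hi (min ε γ / 2) ≤
      stabilityConst d D lo hi / min ε γ * Real.log (D / ε) +
        stabilityConst d D lo hi / (ε * γ) := by
  have hC := stabilityConst_pos d D lo hi
  have hμ : 0 < min ε γ := lt_min hε hγ
  have hD_pos : 0 < D := by linarith
  have := Real.log_pos one_lt_two
  have hlog : Real.log 2 ≤ Real.log (D / ε) :=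
    Real.log_le_log two_pos ((le_div_iff₀ hε).2 hD)
  have hμD : min ε γ ≤ D := (min_le_left _ _).trans (by linarith)
  have hinv : 1 + (min ε γ / 2)⁻¹ ≤ (D + 2) / min ε γ := by
    rw [inv_div, add_div]
    gcongr
    rwa [one_le_div hμ]
  set c := |velocityConst d lo hi|
  calc oscConst d D lo hi (min ε γ / 2) ≤ 2 * D * c * ((D + 2) / min ε γ) := by
        unfold oscConst
        gcongr
        exact le_abs_self _
    _ = 2 * D * c * (D + 2) / Real.log 2 / min ε γ * Real.log 2 := by field_simp
    _ ≤ stabilityConst d D lo hi / min ε γ * Real.log (D / ε) := by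
        gcongr
        rw [stabilityConst, abs_of_pos hD_pos]
        exact le_add_of_nonneg_right zero_le_one
    _ ≤ _ := le_add_of_nonneg_right (by positivity)

lemma nonempty_of_infDist_pos {E : Type*} [PseudoMetricSpace E] {s : Set E} {x : E}
    (h : 0 < Metric.infDist x s) : s.Nonempty := by
  by_contra! h_empty
  rw [h_empty, Metric.infDist_empty] at h
  exact h.false

end Stability

end RectifiedFlow

theorem mainTheorem6_general (d : ℕ) (D lo hi : ℝ) :
    ∃ C : ℝ, 0 < C ∧
      ∀ (Ω : Set (RectifiedFlow.Pt d)) (p₀ p₁ q₀ q₁ : RectifiedFlow.Pt d → ℝ),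
        IsCompact Ω → Convex ℝ Ω → Metric.diam Ω = D →
        RectifiedFlow.IsBoundedPair Ω lo hi p₀ p₁ →
        RectifiedFlow.IsOsgood (RectifiedFlow.ratioModulus Ω p₀ p₁) →
        (∀ x ∈ Ω, 0 < q₀ x) → (∀ x ∈ Ω, 0 < q₁ x) →
        BddAbove (RectifiedFlow.logRatio p₀ p₁ q₀ q₁ '' Ω) →
        RectifiedFlow.IsOsgood (RectifiedFlow.ratioModulus Ω q₀ q₁) →
        (∀ x ∈ interior Ω, RectifiedFlow.HasUniqueFlow Ω (RectifiedFlow.velocity Ω p₀ p₁) x) ∧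
        (∀ x ∈ interior Ω, RectifiedFlow.HasUniqueFlow Ω (RectifiedFlow.velocity Ω q₀ q₁) x) ∧
        ∀ (ε γ : ℝ), 0 < ε → 0 < γ → ∀ x ∈ RectifiedFlow.erosion Ω ε,
          ∀ R R' : ℝ → RectifiedFlow.Pt d,
            RectifiedFlow.IsSolution Ω (RectifiedFlow.velocity Ω p₀ p₁) x 1 R →
            RectifiedFlow.IsSolution Ω (RectifiedFlow.velocity Ω q₀ q₁) x 1 R' →
            2 * γ ≤ Metric.infDist (R 1) (frontier Ω) →
            ‖R' 1 - R 1‖ ≤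
              RectifiedFlow.psiInv (RectifiedFlow.ratioModulus Ω p₀ p₁)
                (RectifiedFlow.psi (RectifiedFlow.ratioModulus Ω p₀ p₁)
                    (2 * Metric.diam Ω *
                      (Real.exp (4 * RectifiedFlow.logRatioError Ω p₀ p₁ q₀ q₁) - 1)) +
                  ((C / min ε γ * Real.log (Metric.diam Ω / ε) + C / (ε * γ) : ℝ) : EReal)) ∧
            ∀ L : ℝ, (∀ u : ℝ, 0 ≤ u → RectifiedFlow.ratioModulus Ω p₀ p₁ u ≤ L * u) →
              ‖R' 1 - R 1‖ ≤
                2 * Metric.diam Ω *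
                    (Real.exp (4 * RectifiedFlow.logRatioError Ω p₀ p₁ q₀ q₁) - 1) *
                  Real.exp (C * (L + 1) / min ε γ * Real.log (Metric.diam Ω / ε) +
                    C * (L + 1) / (ε * γ)) := by
  refine ⟨_, RectifiedFlow.stabilityConst_pos d D lo hi, ?_⟩
  rintro Ω p₀ p₁ q₀ q₁ hΩ hc rfl hp hpo hq₀ hq₁ hbdd hqo
  have hr : ∀ x ∈ Ω, RectifiedFlow.logRatio p₀ p₁ q₀ q₁ x ≤
      RectifiedFlow.logRatioError Ω p₀ p₁ q₀ q₁ := fun x hx => le_csSup hbdd ⟨x, hx, rfl⟩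
  have hq := hp.of_logRatio_le hq₀ hq₁ hr
  refine ⟨fun x => hp.hasUniqueFlow_velocity hpo hΩ hc,
    fun x => hq.hasUniqueFlow_velocity hqo hΩ hc, ?_⟩
  intro ε γ hε hγ x hx R R' hR hR' hend
  have hne : Ω.Nonempty := ⟨x, hx (Metric.mem_closedBall_self hε.le)⟩
  have hω := hp.isOsgoodModulus hc hne hpo
  have h_diam : 2 * ε ≤ Metric.diam Ω := RectifiedFlow.two_mul_le_diam hΩ.isBounded
    (RectifiedFlow.nonempty_of_infDist_pos (by linarith)) hε.le hx
  have h_const := RectifiedFlow.oscConst_le_stabilityConst d lo hi hε hγ h_diam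
  have h_osc := RectifiedFlow.oscConst_nonneg (d := d) (Metric.diam_nonneg (s := Ω))
    (hp.hi_div_lo_nonneg hne) (half_pos (lt_min hε hγ)).le
  set r := RectifiedFlow.logRatioError Ω p₀ p₁ q₀ q₁
  have hr_nonneg : 0 ≤ r := RectifiedFlow.logRatioError_nonneg Ω p₀ p₁ q₀ q₁
  have h_exp : 2 * Metric.diam Ω * (Real.exp (2 * r) - 1) ≤
      2 * Metric.diam Ω * (Real.exp (4 * r) - 1) := by gcongr; norm_num
  have h_psi := (hp.norm_sub_le_psiInv hpo hq hqo hΩ hc hr hε hγ hx hR hR' hend).trans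
    (hω.psiInv_psi_add_mono h_exp h_const)
  refine ⟨h_psi, fun L hL => ?_⟩
  refine (h_psi.trans (hω.psiInv_psi_add_le_mul_exp hL (mul_nonneg (by positivity)
    (sub_nonneg.2 (Real.one_le_exp (by positivity)))) (h_osc.trans h_const))).trans_eq ?_
  ring_nf

theorem mainTheorem6 (d : ℕ) (D lo hi : ℝ) (hlo : 0 < lo) :
    ∃ C : ℝ, 0 < C ∧
      ∀ (Ω : Set (RectifiedFlow.Pt d)) (p₀ p₁ q₀ q₁ : RectifiedFlow.Pt d → ℝ),
        -- the bounded case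
        IsCompact Ω → Convex ℝ Ω → (interior Ω).Nonempty → Metric.diam Ω = D →
        RectifiedFlow.IsDensityOn Ω lo hi p₀ → RectifiedFlow.IsDensityOn Ω lo hi p₁ →
        RectifiedFlow.IsOsgood (RectifiedFlow.ratioModulus Ω p₀ p₁) →
        -- the density estimators `q₀`, `q₁`
        (∀ x ∈ Ω, 0 < q₀ x) → (∀ x ∈ Ω, 0 < q₁ x) →
        BddAbove (RectifiedFlow.logRatio p₀ p₁ q₀ q₁ '' Ω) →
        RectifiedFlow.IsOsgood (RectifiedFlow.ratioModulus Ω q₀ q₁) →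
        -- both flows are uniquely defined
        (∀ x ∈ interior Ω, RectifiedFlow.HasUniqueFlow Ω (RectifiedFlow.velocity Ω p₀ p₁) x) ∧
        (∀ x ∈ interior Ω, RectifiedFlow.HasUniqueFlow Ω (RectifiedFlow.velocity Ω q₀ q₁) x) ∧
        -- error bounds; `R` is the path of the flow from `x`, `R'` that of the estimated flow
        ∀ (ε γ : ℝ), 0 < ε → 0 < γ → ∀ x ∈ RectifiedFlow.erosion Ω ε,
          ∀ R R' : ℝ → RectifiedFlow.Pt d,
            RectifiedFlow.IsSolution Ω (RectifiedFlow.velocity Ω p₀ p₁) x 1 R →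
            RectifiedFlow.IsSolution Ω (RectifiedFlow.velocity Ω q₀ q₁) x 1 R' →
            2 * γ ≤ Metric.infDist (R 1) (frontier Ω) →
            ‖R' 1 - R 1‖ ≤
              RectifiedFlow.psiInv (RectifiedFlow.ratioModulus Ω p₀ p₁)
                (RectifiedFlow.psi (RectifiedFlow.ratioModulus Ω p₀ p₁)
                    (2 * Metric.diam Ω *
                      (Real.exp (4 * RectifiedFlow.logRatioError Ω p₀ p₁ q₀ q₁) - 1)) +
                  ((C / min ε γ * Real.log (Metric.diam Ω / ε) + C / (ε * γ) : ℝ) : EReal)) ∧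
            ∀ L : ℝ, (∀ u : ℝ, 0 ≤ u → RectifiedFlow.ratioModulus Ω p₀ p₁ u ≤ L * u) →
              ‖R' 1 - R 1‖ ≤
                2 * Metric.diam Ω *
                    (Real.exp (4 * RectifiedFlow.logRatioError Ω p₀ p₁ q₀ q₁) - 1) *
                  Real.exp (C * (L + 1) / min ε γ * Real.log (Metric.diam Ω / ε) +
                    C * (L + 1) / (ε * γ)) := by
  obtain ⟨C, hC, h⟩ := mainTheorem6_general d D lo hi
  exact ⟨C, hC, fun Ω p₀ p₁ q₀ q₁ hΩ hc _ hD hp₀ hp₁ => h Ω p₀ p₁ q₀ q₁ hΩ hc hD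
    ⟨hlo, fun x hx => ⟨hp₀.lower x hx, hp₀.upper x hx⟩,
      fun x hx => ⟨hp₁.lower x hx, hp₁.upper x hx⟩⟩⟩
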